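/- Let $p$ and $\ell$ be distinct odd primes, let $\mathbb F_q$ be the finite field with $q$ elements, $q$ a power of $p$, and let $m\ge 1$ and $n\ge 0$ be integers. A linear code $C\subseteq\mathbb F_q^N$ of length $N$ is \emph{cyclic} if $(c_{N-1},c_0,\dots,c_{N-2})\in C$ for all $(c_0,\dots,c_{N-1})\in C$, and it is \emph{LCD} (linear complementary-dual) if $C\cap C^\perp=\{0\}$, where $C^\perp$ is the dual for the standard Euclidean inner product. For a monic divisor $h(X)$ of $X^N-1$, the cyclic code $\langle h(X)\rangle$ with generator polynomial $h(X)$ is the set of words $(c_0,\dots,c_{N-1})$ such that the class of $\sum_i c_iX^i$ lies in the ideal of $\mathbb F_q[X]/\langle X^N-1\rangle$ generated by $h(X)$. Let $f=\mathrm{ord}_\ell(q)$ be the multiplicative order of $q$ modulo $\ell$, write $q^f=1+\ell^st$ with $\ell\nmid t$, and for $1\le r\le m$ put $\lambda(r)=f\,\ell^{\max(r-s,0)}$ and $\delta(r)=\phi(\ell^r)/\lambda(r)$. Let $g$ be a generator of $(\mathbb Z/\ell^m\mathbb Z)^*$ and $\eta$ a primitive $\ell^m$-th root of unity in an extension field of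 $\mathbb F_q$; for $a\in\mathbb Z/\ell^m\mathbb Z$ let $M_a(X)$ be the minimal polynomial of $\eta^a$ over $\mathbb F_q$. Let $\rho_0=0,\rho_1,\dots,\rho_e$ represent all the distinct $q$-cyclotomic cosets $C_t=\{tq^i: i\ge 0\}$ modulo $\ell^m$, each exactly once. For a nonzero polynomial $h$, let $\hat h$ be the monic scalar multiple of $h$; $\hat M_a(-X)$ denotes the monic scalar multiple of $M_a(-X)$. Then $e=\sum_{r=1}^m\delta(r)$, and the following hold. (i) If $f$ is odd, then there are exactly $2^{e+2}$ LCD cyclic codes of length $2\ell^mp^n$ over $\mathbb F_q$, and they are exactly the codes with generator polynomial $$(X-1)^{\varepsilon_0}(X+1)^{\epsilon_0}\prod_{r=1}^{m}\prod_{k=0}^{\frac{\delta(r)}2-1} M_{\ell^{m-r}g^k}(X)^{\varepsilon^r_k}\,M_{-\ell^{m-r}g^k}(X)^{\varepsilon^r_k}\,\hat M_{\ell^{m-r}g^k}(-X)^{\sigma^r_k}\,\hat M_{-\ell^{m-r}g^k}(-X)^{\sigma^r_k},$$ where $\varepsilon_0,\epsilon_0,\varepsilon^r_k,\sigma^r_k\in\{0,p^n\}$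 for all $1\le r\le m$ and $0\le k\le\frac{\delta(r)}2-1$. (ii) If $f$ is even, then there are exactly $2^{2(e+1)}$ LCD cyclic codes of length $2\ell^mp^n$ over $\mathbb F_q$, and they are exactly the codes with generator polynomial $$\prod_{i=0}^{e}\hat M_{\rho_i}(X)^{\varepsilon_i}\,\hat M_{\rho_i}(-X)^{\epsilon_i},\qquad \varepsilon_i,\epsilon_i\in\{0,p^n\},\quad i=0,1,\dots,e.$$ -/

import Mathlib

open Polynomial

namespace RepeatedRootCode

noncomputable section

/-! ### Linear codes, cyclic codes, duals -/

/-- A linear code of length `N` is cyclic if `(c_{N-1}, c_0, …, c_{N-2})` belongs to it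
whenever `(c_0, c_1, …, c_{N-1})` does. -/
def IsCyclicCode {F : Type*} [Field F] {N : ℕ} (C : Submodule F (Fin N → F)) : Prop :=
  ∀ c ∈ C, (fun i => c ((finRotate N).symm i)) ∈ C

/-- The dual code for the standard Euclidean inner product. -/
def dualCode {F : Type*} [Field F] {N : ℕ} (C : Submodule F (Fin N → F)) :
    Submodule F (Fin N → F) where
  carrier := {u | ∀ v ∈ C, u ⬝ᵥ v = 0}
  add_mem' := by
    intro a b ha hb v hv
    rw [add_dotProduct, ha v hv, hb v hv, add_zero]
  zero_mem' := by
    intro v _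
    exact zero_dotProduct v
  smul_mem' := by
    intro c x hx v hv
    rw [smul_dotProduct, hx v hv, smul_zero]

/-- Linear complementary-dual codes. -/
def IsLCD {F : Type*} [Field F] {N : ℕ} (C : Submodule F (Fin N → F)) : Prop :=
  C ⊓ dualCode C = ⊥

/-- The word `(c_0, …, c_{N-1})` as the polynomial `∑ c_i X^i`. -/
def wordPoly (F : Type*) [Field F] (N : ℕ) : (Fin N → F) →ₗ[F] F[X] :=
  ∑ i : Fin N, (monomial (i : ℕ)).comp (LinearMap.proj i)

/-- The ideal `⟨X^N - 1⟩` of `F[X]`. -/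
def cyclicIdeal (F : Type*) [Field F] (N : ℕ) : Ideal F[X] :=
  Ideal.span {X ^ N - 1}

/-- The code `⟨g(X)⟩` of length `N`: the words whose class in `F[X]/⟨X^N - 1⟩` lies in the
ideal generated by the class of `g`. -/
def generatedCode {F : Type*} [Field F] (N : ℕ) (g : F[X]) : Submodule F (Fin N → F) :=
  ((Ideal.span {Ideal.Quotient.mk (cyclicIdeal F N) g}).restrictScalars F).comap
    ((Ideal.Quotient.mkₐ F (cyclicIdeal F N)).toLinearMap.comp (wordPoly F N))

/-- `g` is the generator polynomial of the cyclic code `C` of length `N`. -/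
def IsGeneratorPolynomial {F : Type*} [Field F] {N : ℕ} (C : Submodule F (Fin N → F))
    (g : F[X]) : Prop :=
  g.Monic ∧ g ∣ X ^ N - 1 ∧ C = generatedCode N g

/-- The monic polynomial `f̂` associated with `f`. -/
def hat {F : Type*} [Field F] (f : F[X]) : F[X] :=
  C f.leadingCoeff⁻¹ * f

/-! ### Cyclotomic cosets and the associated numbers -/

/-- The `q`-cyclotomic coset of `t` modulo `L`. -/
def cyclotomicCoset (q L : ℕ) (t : ZMod L) : Set (ZMod L) :=
  {x | ∃ i : ℕ, x = t * (q : ZMod L) ^ i}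

/-- `ρ_0 = 0, ρ_1, …, ρ_e` represent all the `q`-cyclotomic cosets modulo `L`, each exactly
once. -/
def IsCosetEnumeration (q L e : ℕ) (ρ : Fin (e + 1) → ZMod L) : Prop :=
  ρ 0 = 0 ∧ Function.Injective (fun i => cyclotomicCoset q L (ρ i)) ∧
    ∀ t : ZMod L, ∃ i, cyclotomicCoset q L (ρ i) = cyclotomicCoset q L t

/-- `f = ord_ℓ(q)`. -/
def ordMod (ℓ q : ℕ) : ℕ := orderOf (q : ZMod ℓ)

/-- The exponent `s` in `q^f = 1 + ℓ^s t`, `ℓ ∤ t`. -/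
def sVal (ℓ q : ℕ) : ℕ := padicValNat ℓ (q ^ ordMod ℓ q - 1)

/-- `λ(r) = f ℓ^{max(r-s,0)}`; the subtraction of natural numbers is the truncated one. -/
def lam (ℓ q r : ℕ) : ℕ := ordMod ℓ q * ℓ ^ (r - sVal ℓ q)

/-- `δ(r) = φ(ℓ^r) / λ(r)`. -/
def delta (ℓ q r : ℕ) : ℕ := Nat.totient (ℓ ^ r) / lam ℓ q r

/-- `M_a(X)`, the minimal polynomial over `F` of `η^a`, where `η` is an `L`-th root of unity
in an extension of `F` and `a` is an integer modulo `L`. -/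
def minPow (F : Type*) {K : Type*} [Field F] [Field K] [Algebra F K] {L : ℕ} (η : K)
    (a : ZMod L) : F[X] :=
  minpoly F (η ^ a.val)

/-! ### The two families of generators -/

/-- The element `ℓ^{m-r} g^k` modulo `ℓ^m`. -/
def rep {ℓ m : ℕ} (g : (ZMod (ℓ ^ m))ˣ) (r k : ℕ) : ZMod (ℓ ^ m) :=
  (ℓ : ZMod (ℓ ^ m)) ^ (m - r) * (g : ZMod (ℓ ^ m)) ^ k

/-- The product
`(X-1)^{a} (X+1)^{b} ∏_r ∏_k M_{ρ}(X)^{ε r k} M_{-ρ}(X)^{ε r k} M̂_{ρ}(-X)^{σ r k} M̂_{-ρ}(-X)^{σ r k}`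
with `ρ = ℓ^{m-r} g^k`, `1 ≤ r ≤ m`, `0 ≤ k ≤ δ(r)/2 - 1`. -/
def oddGenerator (F : Type*) {K : Type*} [Field F] [Field K] [Algebra F K] {ℓ m : ℕ} (q : ℕ)
    (η : K) (g : (ZMod (ℓ ^ m))ˣ) (a b : ℕ) (ε σ : ℕ → ℕ → ℕ) : F[X] :=
  (X - 1) ^ a * (X + 1) ^ b *
    ∏ r ∈ Finset.Icc 1 m, ∏ k ∈ Finset.range (delta ℓ q r / 2),
      (minPow F η (rep g r k) ^ ε r k * minPow F η (-rep g r k) ^ ε r k *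
        hat ((minPow F η (rep g r k)).comp (-X)) ^ σ r k *
        hat ((minPow F η (-rep g r k)).comp (-X)) ^ σ r k)

/-- The product `∏_{i=0}^{e} M̂_{ρ_i}(X)^{ε i} M̂_{ρ_i}(-X)^{ε' i}`. -/
def evenGenerator (F : Type*) {K : Type*} [Field F] [Field K] [Algebra F K] {L e : ℕ}
    (η : K) (ρ : Fin (e + 1) → ZMod L) (ε ε' : Fin (e + 1) → ℕ) : F[X] :=
  ∏ i : Fin (e + 1),
    (hat (minPow F η (ρ i)) ^ ε i * hat ((minPow F η (ρ i)).comp (-X)) ^ ε' i)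

end

end RepeatedRootCode

open RepeatedRootCode

/-! Let `N = 2 * ℓ ^ m * p ^ n`. A cyclic code of length `N` is an ideal modulo `X ^ N - 1`, with a
monic generator `g` and a cofactor `h`, `g * h = X ^ N - 1`. Modulo `X ^ N - 1` the power `X ^ (N -
1)` is the inverse of `X`, and the inner product of `u` and `v` is the constant term of `u(X)
v(1/X)`. Hence the code is LCD exactly when `h` is coprime to `g(1/X)`: no root of `h` is the
inverse of a root of `g` (`isLCD_generatedCode_iff`, `isLCD_generatedCode_iff_roots`).

Since `X ^ N - 1` is the `p ^ n`-th power of the separable polynomial `X ^ (2 * ℓ ^ m) - 1`, this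
criterion makes the roots of `g` closed under inversion and disjoint from those of `h`. They are
closed under conjugation anyway, so `g` takes each orbit of roots under conjugation and inversion
either with full multiplicity `p ^ n` or not at all, and every such choice works. There are thus `2
^ (number of orbits)` LCD codes (`cyclic_lcd_classification`).

The roots are `±η ^ a`. As `q` is odd, Frobenius keeps the sign and sends `a` to `q * a`; inversion
keeps the sign and sends `a` to `-a`. So the orbits are two copies of the classes of `ZMod (ℓ ^ m)`
under multiplication by `q` and `-1` (`signed_classification`).

The elements `ℓ ^ (m - r) * u`, `u` a unit, fall into cosets indexed by the units modulo `ℓ ^ r`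
divided by the powers of `q`. This is a cyclic group of order `δ(r)` generated by the class of `g`,
the order of `q` being `λ(r)` by lifting the exponent. If `f` is even, `-1` is a power of `q` and
the classes are the `e + 1` cosets. If `f` is odd, `-1` is the element of order two in each
quotient, the nonzero cosets pair up, and there are `1 + e / 2` classes. -/

namespace RepeatedRootCode

/-! ### Cyclic codes as ideals modulo `X ^ N - 1`. -/

section Words

variable {F : Type*} [Field F] {N : ℕ}

theorem wordPoly_apply (c : Fin N → F) :
    wordPoly F N c = ∑ i : Fin N, monomial (i : ℕ) (c i) := by
  simp [wordPoly]

theorem coeff_wordPoly (c : Fin N → F) (i : Fin N) : (wordPoly F N c).coeff i = c i := by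
  simp [wordPoly_apply, finsetSum_coeff, coeff_monomial, Fin.val_inj]

theorem degree_wordPoly_lt (c : Fin N → F) : (wordPoly F N c).degree < N := by
  rw [degree_lt_iff_coeff_zero]
  intro k hk
  rw [wordPoly_apply, finsetSum_coeff]
  exact Finset.sum_eq_zero fun i _ => coeff_monomial_of_ne _ (by have := i.2; omega)

theorem wordPoly_injective : Function.Injective (wordPoly F N) := fun a b h => by
  ext i
  rw [← coeff_wordPoly a i, h, coeff_wordPoly]

theorem exists_wordPoly_eq {f : F[X]} (hf : f.degree < N) : ∃ c, wordPoly F N c = f := by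
  refine ⟨fun i => f.coeff i, ?_⟩
  rw [wordPoly_apply, Fin.sum_univ_eq_sum_range (fun i => monomial i (f.coeff i)) N]
  by_cases h0 : f = 0
  · simp [h0]
  · exact (f.as_sum_range' N ((natDegree_lt_iff_degree_lt h0).2 hf)).symm

theorem monic_X_pow_sub_one (hN : N ≠ 0) : (X ^ N - 1 : F[X]).Monic := by
  simpa using monic_X_pow_sub_C (1 : F) hN

theorem degree_X_pow_sub_one (hN : N ≠ 0) : (X ^ N - 1 : F[X]).degree = N := by
  simpa using degree_X_pow_sub_C (Nat.pos_of_ne_zero hN) (1 : F)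

theorem eq_zero_of_dvd_wordPoly (hN : N ≠ 0) {c : Fin N → F}
    (h : X ^ N - 1 ∣ wordPoly F N c) : c = 0 := by
  apply wordPoly_injective
  rw [map_zero]
  exact eq_zero_of_dvd_of_degree_lt h (by rw [degree_X_pow_sub_one hN]; exact degree_wordPoly_lt c)

theorem exists_wordPoly_congr (hN : N ≠ 0) (f : F[X]) :
    ∃ c, X ^ N - 1 ∣ f - wordPoly F N c := by
  obtain ⟨c, hc⟩ := exists_wordPoly_eq (N := N) (f := f %ₘ (X ^ N - 1)) (by
    rw [← degree_X_pow_sub_one (F := F) hN]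
    exact degree_modByMonic_lt _ (monic_X_pow_sub_one hN))
  refine ⟨c, ?_⟩
  rw [hc]
  exact ⟨f /ₘ (X ^ N - 1), by
    linear_combination -modByMonic_add_div f (X ^ N - 1)⟩

/-- Changing a representative modulo `X ^ N - 1` does not affect divisibility by a divisor of `X ^ N
- 1`, so the quotient ring can be forgotten. -/
theorem mem_generatedCode {g : F[X]} (hg : g ∣ X ^ N - 1) (c : Fin N → F) :
    c ∈ generatedCode N g ↔ g ∣ wordPoly F N c := by
  change Ideal.Quotient.mk (cyclicIdeal F N) (wordPoly F N c) ∈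
    Ideal.span {Ideal.Quotient.mk (cyclicIdeal F N) g} ↔ _
  rw [Ideal.mem_span_singleton]
  constructor
  · rintro ⟨k, hk⟩
    obtain ⟨k, rfl⟩ := Ideal.Quotient.mk_surjective k
    rw [← map_mul, Ideal.Quotient.mk_eq_mk_iff_sub_mem, cyclicIdeal,
      Ideal.mem_span_singleton] at hk
    have := dvd_add (hg.trans hk) (dvd_mul_right g k)
    rwa [sub_add_cancel] at this
  · exact fun h => map_dvd _ h

theorem dvd_of_generatedCode_le (hN : N ≠ 0) {g g' : F[X]} (hg : g ∣ X ^ N - 1)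
    (hg' : g' ∣ X ^ N - 1) (h : generatedCode N g ≤ generatedCode N g') : g' ∣ g := by
  obtain ⟨c, hc⟩ := exists_wordPoly_congr hN g
  have h1 : c ∈ generatedCode N g := (mem_generatedCode hg c).2
    ((dvd_sub_right dvd_rfl).1 (hg.trans hc))
  have h2 := (mem_generatedCode hg' c).1 (h h1)
  exact (dvd_sub_left h2).1 (hg'.trans hc)

theorem eq_of_generatedCode_eq (hN : N ≠ 0) {g g' : F[X]} (hm : g.Monic) (hm' : g'.Monic)
    (hg : g ∣ X ^ N - 1) (hg' : g' ∣ X ^ N - 1) (h : generatedCode N g = generatedCode N g') :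
    g = g' :=
  eq_of_monic_of_associated hm hm' (associated_of_dvd_dvd
    (dvd_of_generatedCode_le hN hg' hg h.ge) (dvd_of_generatedCode_le hN hg hg' h.le))

/-- Only the last coordinate wraps around, and it contributes `c_{N-1} (X ^ N - 1)`; the other terms
cancel. -/
theorem dvd_X_mul_wordPoly_sub_shift (c : Fin N → F) :
    X ^ N - 1 ∣ X * wordPoly F N c - wordPoly F N (fun i => c ((finRotate N).symm i)) := by
  rw [wordPoly_apply, wordPoly_apply,
    ← Equiv.sum_comp (finRotate N) (fun i => monomial (i : ℕ) (c ((finRotate N).symm i))),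
    Finset.mul_sum, ← Finset.sum_sub_distrib]
  refine Finset.dvd_sum fun i _ => ?_
  rw [Equiv.symm_apply_apply, X_mul_monomial]
  obtain _ | n := N
  · exact i.elim0
  rcases eq_or_ne i (Fin.last n) with rfl | hi
  · rw [finRotate_last]
    refine ⟨C (c (Fin.last n)), ?_⟩
    simp [← C_mul_X_pow_eq_monomial]
    ring
  · have : ((finRotate (n + 1) i : Fin (n + 1)) : ℕ) = i + 1 :=
      coe_finRotate_of_ne_last hi
    rw [this, sub_self]
    exact dvd_zero _

/-- The polynomials congruent to a word of `D` form an ideal, cyclicity giving stability under `X`.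
Its monic generator divides `X ^ N - 1`, which is congruent to the zero word. -/
theorem IsCyclicCode.exists_generator (hN : N ≠ 0) {D : Submodule F (Fin N → F)}
    (hD : IsCyclicCode D) : ∃ g, IsGeneratorPolynomial D g := by
  classical
  let I : Ideal F[X] :=
    { carrier := {f | ∃ c ∈ D, X ^ N - 1 ∣ f - wordPoly F N c}
      add_mem' := by
        rintro a b ⟨c, hc, h⟩ ⟨c', hc', h'⟩
        refine ⟨c + c', D.add_mem hc hc', ?_⟩
        rw [map_add, add_sub_add_comm]
        exact dvd_add h h'
      zero_mem' := ⟨0, D.zero_mem, by simp⟩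
      smul_mem' := by
        have hX : ∀ k : ℕ, ∀ f : F[X], (∃ c ∈ D, X ^ N - 1 ∣ f - wordPoly F N c) →
            ∃ c ∈ D, X ^ N - 1 ∣ X ^ k * f - wordPoly F N c := by
          intro k
          induction k with
          | zero => simp
          | succ k ih =>
            intro f hf
            obtain ⟨c, hc, h⟩ := ih f hf
            refine ⟨_, hD c hc, ?_⟩
            have := dvd_add (h.mul_left X) (dvd_X_mul_wordPoly_sub_shift c)
            convert this using 1
            ring
        intro r f hf
        rw [smul_eq_mul]
        induction r using Polynomial.induction_on' with
        | add a b ha hb =>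
          obtain ⟨c, hc, h⟩ := ha
          obtain ⟨c', hc', h'⟩ := hb
          refine ⟨c + c', D.add_mem hc hc', ?_⟩
          rw [map_add, add_mul, add_sub_add_comm]
          exact dvd_add h h'
        | monomial k a =>
          obtain ⟨c, hc, h⟩ := hX k f hf
          refine ⟨a • c, D.smul_mem a hc, ?_⟩
          have := h.mul_left (C a)
          convert this using 1
          rw [map_smul, smul_eq_C_mul, ← C_mul_X_pow_eq_monomial]
          ring }
  have hI : ∀ f, f ∈ I ↔ ∃ c ∈ D, X ^ N - 1 ∣ f - wordPoly F N c := fun f => Iff.rfl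
  have hP : (X ^ N - 1 : F[X]) ∈ I := (hI _).2 ⟨0, D.zero_mem, by simp⟩
  obtain ⟨g₀, hg₀⟩ := (IsPrincipalIdealRing.principal I).principal
  have hmem : ∀ f, f ∈ I ↔ g₀ ∣ f := fun f => by
    rw [hg₀, Ideal.submodule_span_eq, Ideal.mem_span_singleton]
  have hg₀0 : g₀ ≠ 0 := by
    rintro rfl
    exact (monic_X_pow_sub_one (F := F) hN).ne_zero (zero_dvd_iff.1 ((hmem _).1 hP))
  have hmem' : ∀ f, f ∈ I ↔ normalize g₀ ∣ f := fun f => by rw [hmem, normalize_dvd_iff]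
  refine ⟨normalize g₀, monic_normalize hg₀0, (hmem' _).1 hP, ?_⟩
  ext c
  rw [mem_generatedCode ((hmem' _).1 hP), ← hmem', hI]
  constructor
  · exact fun hc => ⟨c, hc, by simp⟩
  · rintro ⟨c', hc', h⟩
    rw [← map_sub] at h
    rwa [sub_eq_zero.1 (eq_zero_of_dvd_wordPoly hN h)]

theorem isCyclicCode_generatedCode {g : F[X]} (hg : g ∣ X ^ N - 1) :
    IsCyclicCode (generatedCode N g) := by
  intro c hc
  rw [mem_generatedCode hg] at hc ⊢
  exact (dvd_sub_right (hc.mul_left X)).1 (hg.trans (dvd_X_mul_wordPoly_sub_shift c))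

end Words

/-! ### Euclidean duality and the coprimality criterion for LCD codes. -/

section Duality

variable {F : Type*} [Field F] {N : ℕ}

/-- The constant coefficient of the remainder modulo `X ^ N - 1`. -/
noncomputable def cyclicTrace (F : Type*) [Field F] (N : ℕ) : F[X] →ₗ[F] F :=
  (lcoeff F 0).comp (modByMonicHom (X ^ N - 1))

theorem cyclicTrace_eq_of_dvd_sub (hN : N ≠ 0) {a b : F[X]} (h : X ^ N - 1 ∣ a - b) :
    cyclicTrace F N a = cyclicTrace F N b := by
  rw [← sub_eq_zero, ← map_sub]
  have : (a - b) %ₘ (X ^ N - 1) = 0 :=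
    (modByMonic_eq_zero_iff_dvd (monic_X_pow_sub_one hN)).2 h
  simp [cyclicTrace, modByMonicHom, this]

theorem cyclicTrace_eq_zero_of_dvd (hN : N ≠ 0) {a : F[X]} (h : X ^ N - 1 ∣ a) :
    cyclicTrace F N a = 0 := by
  rw [cyclicTrace_eq_of_dvd_sub hN (b := 0) (by simpa using h), map_zero]

theorem cyclicTrace_X_pow (hN : N ≠ 0) (k : ℕ) :
    cyclicTrace F N (X ^ k) = if N ∣ k then 1 else 0 := by
  have h : (X ^ N - 1 : F[X]) ∣ X ^ k - X ^ (k % N) := by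
    have h1 : (X ^ N - 1 : F[X]) ∣ X ^ (N * (k / N)) - 1 := by
      simpa [pow_mul] using sub_dvd_pow_sub_pow (X ^ N : F[X]) 1 (k / N)
    have h2 : (X ^ k - X ^ (k % N) : F[X]) = (X ^ (N * (k / N)) - 1) * X ^ (k % N) := by
      conv_lhs => rw [← Nat.div_add_mod k N, pow_add]
      simp [sub_mul]
    rw [h2]
    exact h1.mul_right _
  rw [cyclicTrace_eq_of_dvd_sub hN h]
  have hlt : (X ^ (k % N) : F[X]).degree < (X ^ N - 1 : F[X]).degree := by
    rw [degree_X_pow_sub_one hN, degree_X_pow]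
    exact_mod_cast Nat.mod_lt k (Nat.pos_of_ne_zero hN)
  simp [cyclicTrace, modByMonicHom, (modByMonic_eq_self_iff (monic_X_pow_sub_one hN)).2 hlt,
    coeff_X_pow, Nat.dvd_iff_mod_eq_zero, eq_comm]

/-- The product `X ^ i * X ^ ((N - 1) * j)` represents `X ^ (i - j)`, whose constant term is nonzero
only for `i = j`. -/
theorem dotProduct_eq_cyclicTrace (hN : N ≠ 0) (u v : Fin N → F) :
    u ⬝ᵥ v = cyclicTrace F N (wordPoly F N u * (wordPoly F N v).comp (X ^ (N - 1))) := by
  have key : ∀ i j : Fin N, N ∣ i + (N - 1) * j ↔ i = j := by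
    intro i j
    have h : (i + (N - 1) * j : ℕ) + j = i + N * j := by
      obtain ⟨n, rfl⟩ := Nat.exists_eq_succ_of_ne_zero hN
      simp; ring
    have h1 : N ∣ i + (N - 1) * j ↔ (i : ℕ) ≡ j [MOD N] := by
      constructor
      · intro hd
        have h2 : (i + N * j : ℕ) ≡ j [MOD N] := by
          rw [← h]
          simpa using (Nat.modEq_zero_iff_dvd.2 hd).add_right (j : ℕ)
        exact (by simp [Nat.ModEq] : (i : ℕ) ≡ i + N * j [MOD N]).trans h2
      · intro hm
        rw [← Nat.modEq_zero_iff_dvd]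
        apply Nat.ModEq.add_right_cancel' (j : ℕ)
        rw [h, zero_add]
        exact (by simp [Nat.ModEq] : (i + N * j : ℕ) ≡ i [MOD N]).trans hm
    rw [h1, Nat.ModEq, Nat.mod_eq_of_lt i.2, Nat.mod_eq_of_lt j.2, Fin.val_inj]
  simp only [wordPoly_apply, ← C_mul_X_pow_eq_monomial, Polynomial.sum_comp,
    Finset.sum_mul, Finset.mul_sum, map_sum, mul_comp, C_comp, X_pow_comp]
  have h2 : ∀ i j : Fin N, cyclicTrace F N (C (u i) * X ^ (i : ℕ) *
      (C (v j) * (X ^ (N - 1)) ^ (j : ℕ))) = if i = j then u i * v j else 0 := by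
    intro i j
    have : (C (u i) * X ^ (i : ℕ) * (C (v j) * (X ^ (N - 1)) ^ (j : ℕ)) : F[X]) =
        (u i * v j) • X ^ (i + (N - 1) * j : ℕ) := by
      rw [smul_eq_C_mul, C_mul, pow_add, pow_mul]; ring
    rw [this, map_smul, cyclicTrace_X_pow hN]
    simp [key]
  simp [h2, dotProduct]

theorem X_pow_sub_one_dvd_comp (a : F[X]) (k : ℕ) (h : X ^ N - 1 ∣ a) :
    X ^ N - 1 ∣ a.comp (X ^ k) := by
  obtain ⟨b, rfl⟩ := h
  rw [mul_comp]
  refine Dvd.dvd.mul_right ?_ _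
  simpa [← pow_mul, mul_comm] using sub_dvd_pow_sub_pow (X ^ N : F[X]) 1 k

/-- Nondegeneracy of the trace form: multiplying by `X ^ (-j)` and taking the constant term reads
off the `j`-th coefficient of the remainder. -/
theorem X_pow_sub_one_dvd_of_cyclicTrace (hN : N ≠ 0) {f : F[X]}
    (h : ∀ j, cyclicTrace F N (f * (X ^ (N - 1)) ^ j) = 0) : X ^ N - 1 ∣ f := by
  obtain ⟨c, hc⟩ := exists_wordPoly_congr hN f
  have h0 : c = 0 := by
    ext j
    have h1 := dotProduct_eq_cyclicTrace hN c (Pi.single j 1)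
    have h2 : wordPoly F N (Pi.single j 1) = X ^ (j : ℕ) := by
      rw [wordPoly_apply, Finset.sum_eq_single j]
      · simp [← C_mul_X_pow_eq_monomial]
      · intro b _ hb
        simp [hb]
      · simp
    rw [h2, X_pow_comp, ← cyclicTrace_eq_of_dvd_sub hN (a := f * (X ^ (N - 1)) ^ (j : ℕ)) (by
      rw [← sub_mul]; exact hc.mul_right _), h] at h1
    simpa using h1
  simpa [h0] using hc

theorem mem_dualCode_generatedCode (hN : N ≠ 0) {g : F[X]} (hg : g ∣ X ^ N - 1)
    (u : Fin N → F) :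
    u ∈ dualCode (generatedCode N g) ↔
      X ^ N - 1 ∣ wordPoly F N u * g.comp (X ^ (N - 1)) := by
  constructor
  · intro hu
    refine X_pow_sub_one_dvd_of_cyclicTrace hN fun j => ?_
    obtain ⟨v, hv⟩ := exists_wordPoly_congr hN (g * X ^ j)
    have hvm : v ∈ generatedCode N g := (mem_generatedCode hg v).2
      ((dvd_sub_right (dvd_mul_right g _)).1 (hg.trans hv))
    have h1 : u ⬝ᵥ v = 0 := hu v hvm
    rw [dotProduct_eq_cyclicTrace hN] at h1
    rw [← h1]
    apply cyclicTrace_eq_of_dvd_sub hN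
    have := (X_pow_sub_one_dvd_comp _ (N - 1) hv).mul_left (wordPoly F N u)
    convert this using 1
    simp only [sub_comp, mul_comp, X_pow_comp]
    ring
  · intro h v hv
    obtain ⟨k, hk⟩ := (mem_generatedCode hg v).1 hv
    rw [dotProduct_eq_cyclicTrace hN, hk, mul_comp, ← mul_assoc]
    exact cyclicTrace_eq_zero_of_dvd hN (h.mul_right _)

/-- A word `g * k` of the code is in the dual iff `h` divides `k * g(1/X)`. Coprimality then forces
`h ∣ k`, that is, the zero word. -/
theorem isLCD_generatedCode_iff (hN : N ≠ 0) {g h : F[X]} (hgh : g * h = X ^ N - 1) :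
    IsLCD (generatedCode N g) ↔ IsCoprime h (g.comp (X ^ (N - 1))) := by
  have hg : g ∣ X ^ N - 1 := ⟨h, hgh.symm⟩
  have hP0 : g * h ≠ 0 := hgh ▸ (monic_X_pow_sub_one hN).ne_zero
  have hg0 : g ≠ 0 := left_ne_zero_of_mul hP0
  constructor
  · intro hL
    classical
    by_contra hcop
    rw [← EuclideanDomain.gcd_isUnit_iff] at hcop
    set d := EuclideanDomain.gcd h (g.comp (X ^ (N - 1)))
    obtain ⟨h', hh'⟩ : d ∣ h := EuclideanDomain.gcd_dvd_left _ _
    obtain ⟨k, hk⟩ : d ∣ g.comp (X ^ (N - 1)) := EuclideanDomain.gcd_dvd_right _ _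
    -- With `d` a nontrivial common factor and `h' = h / d`, the word of `g * h'` is nonzero and
    -- self-orthogonal to the code.
    obtain ⟨u, hu⟩ := exists_wordPoly_congr hN (g * h')
    have hu1 : u ∈ generatedCode N g := (mem_generatedCode hg u).2
      ((dvd_sub_right (dvd_mul_right g _)).1 (hg.trans hu))
    have hu2 : u ∈ dualCode (generatedCode N g) := by
      rw [mem_dualCode_generatedCode hN hg]
      have h1 := hu.mul_right (g.comp (X ^ (N - 1)))
      rw [sub_mul] at h1
      refine (dvd_sub_right ?_).1 h1
      exact ⟨k, by rw [← hgh, hk, hh']; ring⟩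
    have hu0 : u = 0 := by
      have : u ∈ generatedCode N g ⊓ dualCode (generatedCode N g) := ⟨hu1, hu2⟩
      rw [hL] at this
      simpa using this
    rw [hu0, map_zero, sub_zero, ← hgh, mul_dvd_mul_iff_left hg0, hh'] at hu
    have h'0 : h' ≠ 0 := by
      rintro rfl
      simp [hh'] at hP0
    obtain ⟨w, hw⟩ := hu
    refine hcop (IsUnit.of_mul_eq_one w (mul_left_cancel₀ h'0 ?_))
    rw [mul_one]
    conv_rhs => rw [hw]
    ring
  · intro hcop
    rw [IsLCD, eq_bot_iff]
    rintro u ⟨hu1, hu2⟩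
    obtain ⟨k, hk⟩ := (mem_generatedCode hg u).1 hu1
    have h2 := (mem_dualCode_generatedCode hN hg u).1 hu2
    rw [hk, ← hgh, mul_assoc, mul_dvd_mul_iff_left hg0] at h2
    have h3 := hcop.dvd_of_dvd_mul_right h2
    rw [Submodule.mem_bot]
    apply eq_zero_of_dvd_wordPoly hN
    rw [hk, ← hgh]
    exact mul_dvd_mul_left g h3

end Duality

/-! ### LCD codes and orbits of roots under conjugation and inversion. -/

section Classification

variable {F K : Type*} [Field F] [Field K] [Algebra F K]

theorem isCoprime_of_no_common_root {a b : F[X]} (ha : (a.map (algebraMap F K)).Splits)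
    (ha0 : a ≠ 0) (h : ∀ α : K, aeval α a = 0 → aeval α b ≠ 0) : IsCoprime a b := by
  refine isCoprime_of_irreducible_dvd (fun h0 => ha0 h0.1) fun z hz hza hzb => ?_
  have hs : (z.map (algebraMap F K)).Splits :=
    ha.of_dvd ((Polynomial.map_ne_zero_iff (algebraMap F K).injective).2 ha0)
      (Polynomial.map_dvd _ hza)
  obtain ⟨α, hα⟩ := hs.exists_eval_eq_zero (by
    rw [degree_map]
    exact (degree_pos_of_irreducible hz).ne')
  rw [eval_map_algebraMap] at hα
  exact h α (aeval_eq_zero_of_dvd_aeval_eq_zero hza hα)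
    (aeval_eq_zero_of_dvd_aeval_eq_zero hzb hα)

theorem isLCD_generatedCode_iff_roots {N : ℕ} (hN : N ≠ 0)
    (hs : ((X ^ N - 1 : F[X]).map (algebraMap F K)).Splits) {g h : F[X]}
    (hgh : g * h = X ^ N - 1) :
    IsLCD (generatedCode N g) ↔ ∀ α : K, aeval α h = 0 → aeval α⁻¹ g ≠ 0 := by
  have hP0 : (X ^ N - 1 : F[X]) ≠ 0 := (monic_X_pow_sub_one hN).ne_zero
  have hh0 : h ≠ 0 := by
    rintro rfl
    simp [← hgh] at hP0
  have hev : ∀ α : K, aeval α h = 0 → aeval α (g.comp (X ^ (N - 1))) = aeval α⁻¹ g := by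
    intro α hα
    have h1 : aeval α (X ^ N - 1 : F[X]) = 0 :=
      aeval_eq_zero_of_dvd_aeval_eq_zero ⟨g, by rw [← hgh, mul_comm]⟩ hα
    have h2 : α ^ N = 1 := by simpa [sub_eq_zero] using h1
    have h3 : α ^ (N - 1) = α⁻¹ := by
      apply eq_inv_of_mul_eq_one_left
      rw [← pow_succ, Nat.sub_add_cancel (Nat.pos_of_ne_zero hN), h2]
    rw [aeval_comp, map_pow, aeval_X, h3]
  rw [isLCD_generatedCode_iff hN hgh]
  constructor
  · rintro ⟨a, b, hab⟩ α hα hg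
    have := congr_arg (aeval α) hab
    simp [hα, hev α hα, hg] at this
  · intro H
    refine isCoprime_of_no_common_root (K := K) ?_ hh0 fun α hα => ?_
    · exact hs.of_dvd ((Polynomial.map_ne_zero_iff (algebraMap F K).injective).2 hP0)
        (Polynomial.map_dvd _ ⟨g, by rw [← hgh, mul_comm]⟩)
    · rw [hev α hα]
      exact H α hα

variable {ι : Type*} [Fintype ι] {L Q : ℕ} {P : ι → F[X]}

theorem aeval_eq_zero_iff_of_mem_orbit {b : F[X]} {α β : K}
    (hb : ∀ γ : K, aeval γ b = 0 → aeval γ⁻¹ b = 0)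
    (h : minpoly F β = minpoly F α ∨ minpoly F β = minpoly F α⁻¹) :
    aeval α b = 0 → aeval β b = 0 := by
  intro hα
  have hd : ∀ γ : K, aeval γ b = 0 → minpoly F β = minpoly F γ → aeval β b = 0 := by
    intro γ hγ hm
    exact aeval_eq_zero_of_dvd_aeval_eq_zero (hm ▸ minpoly.dvd F γ hγ) (minpoly.aeval F β)
  rcases h with h | h
  · exact hd α hα h
  · exact hd α⁻¹ (hb α hα) h

theorem aeval_prod_pow_eq_zero {E : ι → ℕ} {α : K} :
    aeval α (∏ i, P i ^ E i) = 0 ↔ ∃ i, E i ≠ 0 ∧ aeval α (P i) = 0 := by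
  simp [map_prod, Finset.prod_eq_zero_iff, pow_eq_zero_iff', and_comm]

/-- The classification of the cyclic LCD codes of length `L * Q` in terms of the orbits of the
roots of `X ^ L - 1` under conjugation and inversion, `P i` having as roots the `i`-th orbit. -/
theorem cyclic_lcd_classification (hL : L ≠ 0) (hQ : Q ≠ 0)
    (hpow : (X ^ (L * Q) - 1 : F[X]) = (X ^ L - 1) ^ Q)
    (hs : ((X ^ L - 1 : F[X]).map (algebraMap F K)).Splits)
    (hmonic : ∀ i, (P i).Monic) (hprod : ∏ i, P i = X ^ L - 1)
    (hdisj : ∀ i j, ∀ α : K, aeval α (P i) = 0 → aeval α (P j) = 0 → i = j)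
    (hinv : ∀ i, ∀ α : K, aeval α (P i) = 0 → aeval α⁻¹ (P i) = 0)
    (horb : ∀ i, ∀ α β : K, aeval α (P i) = 0 → aeval β (P i) = 0 →
      minpoly F β = minpoly F α ∨ minpoly F β = minpoly F α⁻¹)
    (hroot : ∀ i, ∃ α : K, aeval α (P i) = 0) :
    {C : Submodule F (Fin (L * Q) → F) | IsCyclicCode C ∧ IsLCD C}.ncard
        = 2 ^ Fintype.card ι ∧
      ∀ C : Submodule F (Fin (L * Q) → F), (IsCyclicCode C ∧ IsLCD C) ↔
        ∃ E : ι → ℕ, (∀ i, E i = 0 ∨ E i = Q) ∧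
          IsGeneratorPolynomial C (∏ i, P i ^ E i) := by
  classical
  have hN : L * Q ≠ 0 := mul_ne_zero hL hQ
  have hP0 : (X ^ (L * Q) - 1 : F[X]) ≠ 0 := (monic_X_pow_sub_one hN).ne_zero
  have hsN : ((X ^ (L * Q) - 1 : F[X]).map (algebraMap F K)).Splits := by
    rw [hpow, Polynomial.map_pow]
    exact hs.pow Q
  have hsdvd : ∀ {a : F[X]}, a ∣ X ^ (L * Q) - 1 → (a.map (algebraMap F K)).Splits := by
    intro a ha
    exact hsN.of_dvd ((Polynomial.map_ne_zero_iff (algebraMap F K).injective).2 hP0)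
      (Polynomial.map_dvd _ ha)
  have hPd : ∀ i, P i ^ Q ∣ X ^ (L * Q) - 1 := fun i => by
    rw [hpow, ← hprod]
    exact pow_dvd_pow_of_dvd (Finset.dvd_prod_of_mem P (Finset.mem_univ i)) Q
  have hPd' : ∀ i, P i ∣ X ^ (L * Q) - 1 := fun i => (dvd_pow_self _ hQ).trans (hPd i)
  have hcop : ∀ {i : ι} {b : F[X]}, (∀ α : K, aeval α (P i) = 0 → aeval α b ≠ 0) →
      IsCoprime (P i) b := fun {i b} h =>
    isCoprime_of_no_common_root (hsdvd (hPd' i)) (hmonic i).ne_zero h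
  -- the generator attached to a set of orbits, and the complementary factor
  have hcompl : ∀ E : ι → ℕ, (∀ i, E i = 0 ∨ E i = Q) →
      (∏ i, P i ^ E i) * (∏ i, P i ^ (Q - E i)) = X ^ (L * Q) - 1 := by
    intro E hE
    rw [hpow, ← hprod, ← Finset.prod_mul_distrib, ← Finset.prod_pow]
    refine Finset.prod_congr rfl fun i _ => ?_
    rw [← pow_add]
    congr 1
    rcases hE i with h | h <;> simp [h]
  have hmonE : ∀ E : ι → ℕ, (∏ i, P i ^ E i).Monic := fun E =>
    monic_prod_of_monic _ _ fun i _ => (hmonic i).pow _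
  have hlcd : ∀ E : ι → ℕ, (∀ i, E i = 0 ∨ E i = Q) →
      IsCyclicCode (generatedCode (L * Q) (∏ i, P i ^ E i)) ∧
        IsLCD (generatedCode (L * Q) (∏ i, P i ^ E i)) := by
    intro E hE
    have hc := hcompl E hE
    refine ⟨isCyclicCode_generatedCode ⟨_, hc.symm⟩, ?_⟩
    rw [isLCD_generatedCode_iff_roots (K := K) hN hsN hc]
    intro α hα hα'
    obtain ⟨i, hi, hiα⟩ := aeval_prod_pow_eq_zero.1 hα
    obtain ⟨j, hj, hjα⟩ := aeval_prod_pow_eq_zero.1 hα'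
    obtain rfl := hdisj i j _ (hinv i α hiα) hjα
    rcases hE i with h | h <;> omega
  have hex : ∀ C : Submodule F (Fin (L * Q) → F), IsCyclicCode C ∧ IsLCD C →
      ∃ E : ι → ℕ, (∀ i, E i = 0 ∨ E i = Q) ∧ IsGeneratorPolynomial C (∏ i, P i ^ E i) := by
    rintro C ⟨hC, hCL⟩
    obtain ⟨g, hgm, hgd, rfl⟩ := hC.exists_generator hN
    obtain ⟨h, hgh⟩ := hgd
    have hR := (isLCD_generatedCode_iff_roots (K := K) hN hsN hgh.symm).1 hCL
    have hcover : ∀ α : K, α ^ (L * Q) = 1 → aeval α g = 0 ∨ aeval α h = 0 := by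
      intro α hα
      have h1 : aeval α (X ^ (L * Q) - 1 : F[X]) = 0 := by simp [hα]
      rwa [hgh, map_mul, mul_eq_zero] at h1
    have hroots : ∀ {a : F[X]}, a ∣ X ^ (L * Q) - 1 → ∀ α : K, aeval α a = 0 →
        α ^ (L * Q) = 1 := by
      intro a ha α hα
      have := aeval_eq_zero_of_dvd_aeval_eq_zero ha hα
      simpa [sub_eq_zero] using this
    -- The inverse of a root of `g` is a root of `g` or of `h`; the LCD criterion at `γ⁻¹` excludes
    -- `h`.
    have hginv : ∀ γ : K, aeval γ g = 0 → aeval γ⁻¹ g = 0 := by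
      intro γ hγ
      have h1 := hroots ⟨h, hgh⟩ γ hγ
      refine (hcover γ⁻¹ (by rw [inv_pow, h1, inv_one])).resolve_right fun h2 => ?_
      exact hR _ h2 (by rwa [inv_inv])
    -- An orbit gets the full exponent as soon as it meets the roots of `g`; it is then contained in
    -- them.
    let E : ι → ℕ := fun i => if ∃ α : K, aeval α (P i) = 0 ∧ aeval α g = 0 then Q else 0
    have hE : ∀ i, E i = 0 ∨ E i = Q := fun i => by
      simp only [E]
      split_ifs
      · exact Or.inr rfl
      · exact Or.inl rfl
    refine ⟨E, hE, ?_⟩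
    have hpair : ∀ E' : ι → ℕ, Set.Pairwise (Finset.univ : Finset ι)
        (Function.onFun IsCoprime fun i => P i ^ E' i) := fun E' i _ j _ hij =>
      (hcop fun α h1 h2 => hij (hdisj i j α h1 h2)).pow
    have hA : (∏ i, P i ^ E i) ∣ g := by
      refine Finset.prod_dvd_of_coprime (hpair E) fun i _ => ?_
      by_cases hi : ∃ α : K, aeval α (P i) = 0 ∧ aeval α g = 0
      · obtain ⟨α, h1, h2⟩ := hi
        have : E i = Q := if_pos ⟨α, h1, h2⟩
        rw [this]
        have hc : IsCoprime (P i) h := by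
          refine hcop fun β hβ hβ' => ?_
          have hβg := aeval_eq_zero_iff_of_mem_orbit hginv (horb i α β h1 hβ) h2
          exact hR β hβ' (hginv β hβg)
        exact (hc.pow_left (m := Q)).dvd_of_dvd_mul_right (hgh ▸ hPd i)
      · have : E i = 0 := if_neg hi
        simp [this]
    have hB : (∏ i, P i ^ (Q - E i)) ∣ h := by
      refine Finset.prod_dvd_of_coprime (hpair _) fun i _ => ?_
      by_cases hi : ∃ α : K, aeval α (P i) = 0 ∧ aeval α g = 0
      · have : E i = Q := if_pos hi
        simp [this]
      · have : E i = 0 := if_neg hi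
        rw [this, Nat.sub_zero]
        have hc : IsCoprime (P i) g := hcop fun β hβ hβ' => hi ⟨β, hβ, hβ'⟩
        exact (hc.pow_left (m := Q)).dvd_of_dvd_mul_left (hgh ▸ hPd i)
    -- The two products divide `g` and `h` respectively and multiply to `g * h`, so neither
    -- divisibility is proper.
    have hgA : g = ∏ i, P i ^ E i := by
      obtain ⟨b, hb⟩ := hB
      refine eq_of_monic_of_associated hgm (hmonE E) (associated_of_dvd_dvd ?_ hA)
      refine ⟨b, mul_right_cancel₀ (b := ∏ i, P i ^ (Q - E i)) (hmonE _).ne_zero ?_⟩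
      rw [hcompl E hE, hgh]
      rw [hb]
      ring
    rw [← hgA]
    exact ⟨hgm, ⟨h, hgh⟩, rfl⟩
  have hiff : ∀ C : Submodule F (Fin (L * Q) → F), (IsCyclicCode C ∧ IsLCD C) ↔
      ∃ E : ι → ℕ, (∀ i, E i = 0 ∨ E i = Q) ∧ IsGeneratorPolynomial C (∏ i, P i ^ E i) := by
    refine fun C => ⟨hex C, ?_⟩
    rintro ⟨E, hE, -, -, rfl⟩
    exact hlcd E hE
  refine ⟨?_, hiff⟩
  -- Counting by sets of orbits: `T` is recovered from the roots of the generator polynomial, which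
  -- the code determines.
  let Φ : Set ι → Submodule F (Fin (L * Q) → F) := fun T =>
    generatedCode (L * Q) (∏ i, P i ^ (if i ∈ T then Q else 0))
  have hite : ∀ T : Set ι, ∀ i, (if i ∈ T then Q else 0) = 0 ∨ (if i ∈ T then Q else 0) = Q :=
    fun T i => by split_ifs <;> simp
  have hΦ : Function.Injective Φ := by
    intro T T' hTT
    have h1 := eq_of_generatedCode_eq hN (hmonE _) (hmonE _) ⟨_, (hcompl _ (hite T)).symm⟩
      ⟨_, (hcompl _ (hite T')).symm⟩ hTT
    have hmem : ∀ S : Set ι, ∀ i, ∀ α : K, aeval α (P i) = 0 →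
        (aeval α (∏ i, P i ^ (if i ∈ S then Q else 0)) = 0 ↔ i ∈ S) := by
      intro S i α hα
      rw [aeval_prod_pow_eq_zero]
      constructor
      · rintro ⟨j, hj, hjα⟩
        obtain rfl := hdisj i j α hα hjα
        by_contra hi
        simp [hi] at hj
      · exact fun hi => ⟨i, by simp [hi, hQ], hα⟩
    ext i
    obtain ⟨α, hα⟩ := hroot i
    rw [← hmem T i α hα, h1, hmem T' i α hα]
  have hrange : {C : Submodule F (Fin (L * Q) → F) | IsCyclicCode C ∧ IsLCD C} =
      Set.range Φ := by
    ext C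
    rw [Set.mem_ofPred_eq, hiff]
    constructor
    · rintro ⟨E, hE, -, -, rfl⟩
      refine ⟨{i | E i = Q}, ?_⟩
      simp only [Φ]
      congr 1
      refine Finset.prod_congr rfl fun i _ => ?_
      congr 1
      rcases hE i with h | h <;> simp [h, hQ.symm]
    · rintro ⟨T, rfl⟩
      exact ⟨_, hite T, hmonE _, ⟨_, (hcompl _ (hite T)).symm⟩, rfl⟩
  rw [hrange, ← Set.image_univ, Set.ncard_image_of_injective _ hΦ, Set.ncard_univ]
  simp

/-- Polynomials dividing `X ^ L - 1` whose root sets partition the `L`-th roots of unity. -/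
theorem prod_eq_X_pow_sub_one (hL : L ≠ 0) (hsep : (X ^ L - 1 : F[X]).Separable)
    (hs : ((X ^ L - 1 : F[X]).map (algebraMap F K)).Splits)
    (hmonic : ∀ i, (P i).Monic) (hdvd : ∀ i, P i ∣ X ^ L - 1)
    (hdisj : ∀ i j, ∀ α : K, aeval α (P i) = 0 → aeval α (P j) = 0 → i = j)
    (hcover : ∀ α : K, α ^ L = 1 → ∃ i, aeval α (P i) = 0) :
    ∏ i, P i = X ^ L - 1 := by
  have hP0 : (X ^ L - 1 : F[X]) ≠ 0 := (monic_X_pow_sub_one hL).ne_zero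
  have h1 : ∏ i, P i ∣ X ^ L - 1 := by
    refine Finset.prod_dvd_of_coprime (fun i _ j _ hij => ?_) fun i _ => hdvd i
    refine isCoprime_of_no_common_root (K := K) ?_ (hmonic i).ne_zero
      fun α h1 h2 => hij (hdisj i j α h1 h2)
    exact hs.of_dvd ((Polynomial.map_ne_zero_iff (algebraMap F K).injective).2 hP0)
      (Polynomial.map_dvd _ (hdvd i))
  have hm : (∏ i, P i).Monic := monic_prod_of_monic _ _ fun i _ => hmonic i
  refine eq_of_monic_of_associated hm (monic_X_pow_sub_one hL) (associated_of_dvd_dvd h1 ?_)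
  rw [← Polynomial.map_dvd_map' (algebraMap F K)]
  refine hs.dvd_of_roots_le_roots
    ((Polynomial.map_ne_zero_iff (algebraMap F K).injective).2 hP0) ?_
  -- Separability makes the roots simple, so it suffices that each of them occurs in the product.
  rw [Multiset.le_iff_subset (nodup_roots hsep.map)]
  intro α hα
  have h2 : α ^ L = 1 := by
    have := (mem_roots'.1 hα).2
    simpa [IsRoot.def, sub_eq_zero] using this
  obtain ⟨i, hi⟩ := hcover α h2
  rw [mem_roots', IsRoot.def, eval_map_algebraMap]
  exact ⟨(hm.map _).ne_zero,
    aeval_eq_zero_of_dvd_aeval_eq_zero (Finset.dvd_prod_of_mem P (Finset.mem_univ i)) hi⟩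

end Classification

/-! ### Conjugate elements over a finite field. -/

section Conjugates

variable {F K : Type*} [Field F] [Field K] [Algebra F K]

/-- Conjugates differ by an automorphism of the finite field `F(x, y)`, which is a power of
Frobenius. Passing to `F(x, y)` is needed because `K` may be infinite. -/
theorem minpoly_eq_iff_exists_pow [Fintype F] {x y : K} (hx : IsIntegral F x) :
    minpoly F x = minpoly F y ↔ ∃ i : ℕ, y = x ^ Fintype.card F ^ i := by
  constructor
  · intro h
    have hy : IsIntegral F y := by
      rw [← minpoly.ne_zero_iff, ← h, minpoly.ne_zero_iff]
      exact hx
    have : FiniteDimensional F (IntermediateField.adjoin F {x, y}) :=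
      IntermediateField.finiteDimensional_adjoin_pair hx hy
    have : Finite (IntermediateField.adjoin F {x, y}) := Module.finite_of_finite F
    let x' : IntermediateField.adjoin F {x, y} :=
      ⟨x, IntermediateField.subset_adjoin F _ (by simp)⟩
    let y' : IntermediateField.adjoin F {x, y} :=
      ⟨y, IntermediateField.subset_adjoin F _ (by simp)⟩
    have h' : IsConjRoot F y' x' := by
      rw [← isConjRoot_algHom_iff (IntermediateField.adjoin F {x, y}).val]
      exact h.symm
    obtain ⟨σ, hσ⟩ := h'.exists_algEquiv
    obtain ⟨p, hp⟩ := CharP.exists F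
    have : Fact p.Prime := ⟨CharP.char_is_prime F p⟩
    obtain ⟨i, hi⟩ := FiniteField.exists_forall_apply_eq_pow F p _ σ
    refine ⟨i, ?_⟩
    rw [hi, Nat.card_eq_fintype_card] at hσ
    exact (congr_arg Subtype.val hσ).symm
  · rintro ⟨i, rfl⟩
    induction i with
    | zero => simp
    | succ i ih =>
      rw [ih, pow_succ, pow_mul]
      exact (minpoly.algHom_eq (FiniteField.frobeniusAlgHom F K) (RingHom.injective _) _).symm

theorem hat_minpoly (x : K) : hat (minpoly F x) = minpoly F x := by
  by_cases hx : IsIntegral F x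
  · simp [hat, (minpoly.monic hx).leadingCoeff]
  · simp [hat, minpoly.eq_zero hx]

theorem hat_minpoly_comp_neg_X {x : K} (hx : IsIntegral F x) :
    hat ((minpoly F x).comp (-X)) = minpoly F (-x) := by
  have h1 := minpoly.neg (A := F) x
  have hu : ((-1 : F) ^ (minpoly F x).natDegree) ≠ 0 := pow_ne_zero _ (by simp)
  have h2 : (minpoly F x).comp (-X) =
      C ((-1 : F) ^ (minpoly F x).natDegree) * minpoly F (-x) := by
    rw [h1, C_pow, C_neg, C_1, ← mul_assoc, ← mul_pow]
    simp
  rw [hat, h2, leadingCoeff_mul, leadingCoeff_C, (minpoly.monic hx.neg).leadingCoeff, mul_one,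
    ← mul_assoc, ← C_mul, inv_mul_cancel₀ hu, C_1, one_mul]

end Conjugates

/-! ### Cyclotomic cosets as equivalence classes. -/

section Coset

variable {q L : ℕ}

theorem mem_cyclotomicCoset_self (a : ZMod L) : a ∈ cyclotomicCoset q L a := ⟨0, by simp⟩

theorem mem_cyclotomicCoset_trans {a b c : ZMod L} (hb : b ∈ cyclotomicCoset q L a)
    (hc : c ∈ cyclotomicCoset q L b) : c ∈ cyclotomicCoset q L a := by
  obtain ⟨i, rfl⟩ := hb
  obtain ⟨j, rfl⟩ := hc
  exact ⟨i + j, by rw [pow_add, mul_assoc]⟩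

theorem mem_cyclotomicCoset_symm [NeZero L] (hq : q.Coprime L) {a b : ZMod L}
    (hb : b ∈ cyclotomicCoset q L a) : a ∈ cyclotomicCoset q L b := by
  obtain ⟨i, rfl⟩ := hb
  have h1 : (q : ZMod L) ^ Nat.totient L = 1 := by
    have := congr_arg Units.val (ZMod.pow_totient (ZMod.unitOfCoprime q hq))
    rwa [Units.val_pow_eq_pow_val, ZMod.coe_unitOfCoprime, Units.val_one] at this
  -- By Euler, `q ^ (φ(L) - 1)` inverts `q` modulo `L`.
  refine ⟨i * (Nat.totient L - 1), ?_⟩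
  have h2 : i + i * (Nat.totient L - 1) = Nat.totient L * i := by
    have := Nat.totient_pos.2 (Nat.pos_of_ne_zero (NeZero.ne L))
    obtain ⟨t, ht⟩ := Nat.exists_eq_succ_of_ne_zero this.ne'
    rw [ht]; simp; ring
  rw [mul_assoc, ← pow_add, h2, pow_mul, h1, one_pow, mul_one]

theorem neg_mem_cyclotomicCoset_neg {a b : ZMod L} (hb : b ∈ cyclotomicCoset q L a) :
    -b ∈ cyclotomicCoset q L (-a) := by
  obtain ⟨i, rfl⟩ := hb
  exact ⟨i, by rw [neg_mul]⟩

theorem cyclotomicCoset_eq_iff [NeZero L] (hq : q.Coprime L) {a b : ZMod L} :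
    cyclotomicCoset q L a = cyclotomicCoset q L b ↔ b ∈ cyclotomicCoset q L a := by
  constructor
  · exact fun h => h ▸ mem_cyclotomicCoset_self b
  · intro h
    ext c
    exact ⟨mem_cyclotomicCoset_trans (mem_cyclotomicCoset_symm hq h),
      mem_cyclotomicCoset_trans h⟩

theorem mem_cyclotomicCoset_zero {a : ZMod L} : a ∈ cyclotomicCoset q L 0 ↔ a = 0 := by
  simp [cyclotomicCoset]

end Coset

/-! ### The `2L`-th roots of unity as `±η ^ a`, for odd `L`. -/

section SignedRoots

variable {K : Type*} [Field K] {L : ℕ} {η : K}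

/-- The root of unity `η ^ a` or `-η ^ a`, according to the sign `b`. -/
def signedRoot (η : K) (b : Bool) (a : ZMod L) : K :=
  bif b then -η ^ a.val else η ^ a.val

theorem pow_val_natCast (hη : IsPrimitiveRoot η L) (k : ℕ) :
    η ^ (k : ZMod L).val = η ^ k := by
  rw [ZMod.val_natCast, hη.eq_orderOf, pow_mod_orderOf]

theorem pow_val_add [NeZero L] (hη : IsPrimitiveRoot η L) (a b : ZMod L) :
    η ^ (a + b).val = η ^ a.val * η ^ b.val := by
  rw [← pow_add, ← pow_val_natCast hη (a.val + b.val)]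
  simp

theorem pow_val_neg [NeZero L] (hη : IsPrimitiveRoot η L) (a : ZMod L) :
    η ^ (-a).val = (η ^ a.val)⁻¹ := by
  apply eq_inv_of_mul_eq_one_left
  rw [← pow_val_add hη, neg_add_cancel, ZMod.val_zero, pow_zero]

theorem pow_val_mul_natCast [NeZero L] (hη : IsPrimitiveRoot η L) (a : ZMod L) (k : ℕ) :
    η ^ (a * k).val = (η ^ a.val) ^ k := by
  rw [← pow_mul, ← pow_val_natCast hη (a.val * k)]
  simp

theorem signedRoot_inv [NeZero L] (hη : IsPrimitiveRoot η L) (b : Bool) (a : ZMod L) :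
    (signedRoot η b a)⁻¹ = signedRoot η b (-a) := by
  cases b <;> simp [signedRoot, pow_val_neg hη, inv_neg]

theorem signedRoot_pow [NeZero L] (hη : IsPrimitiveRoot η L) (b : Bool) (a : ZMod L) {q : ℕ} (hq : Odd q)
    (i : ℕ) : signedRoot η b a ^ q ^ i = signedRoot η b (a * (q : ZMod L) ^ i) := by
  have := pow_val_mul_natCast hη a (q ^ i)
  push_cast at this
  cases b <;> simp [signedRoot, this, (hq.pow (n := i)).neg_pow]

/-- Since `L` is odd, the `L`-th power of `±η ^ a` is `±1` and recovers the sign. -/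
theorem signedRoot_injective [NeZero L] (hη : IsPrimitiveRoot η L) (hL : Odd L) (h2 : (2 : K) ≠ 0)
    {b b' : Bool} {a a' : ZMod L} (h : signedRoot η b a = signedRoot η b' a') :
    b = b' ∧ a = a' := by
  have hpow : ∀ (b : Bool) (a : ZMod L), signedRoot η b a ^ L = bif b then -1 else 1 := by
    intro b a
    have : (η ^ a.val) ^ L = 1 := by rw [pow_right_comm, hη.pow_eq_one, one_pow]
    cases b <;> simp [signedRoot, hL.neg_pow, this]
  have h11 : (1 : K) ≠ -1 := fun h => h2 (by linear_combination h)
  have hb : b = b' := by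
    have := hpow b a
    rw [h, hpow] at this
    cases b <;> cases b' <;> simp_all
  subst hb
  refine ⟨rfl, ZMod.val_injective L (hη.pow_inj (ZMod.val_lt a) (ZMod.val_lt a') ?_)⟩
  cases b <;> simpa [signedRoot] using h

theorem exists_signedRoot_eq [NeZero L] (hη : IsPrimitiveRoot η L) (hL : Odd L) {α : K}
    (hα : α ^ (2 * L) = 1) : ∃ b, ∃ a : ZMod L, signedRoot η b a = α := by
  have hex : ∀ β : K, β ^ L = 1 → ∃ a : ZMod L, η ^ a.val = β := by
    intro β hβ
    obtain ⟨i, -, hi⟩ := hη.eq_pow_of_pow_eq_one hβ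
    exact ⟨i, by rw [pow_val_natCast hη, hi]⟩
  rw [mul_comm, pow_mul] at hα
  rcases sq_eq_one_iff.1 hα with h | h
  · obtain ⟨a, ha⟩ := hex α h
    exact ⟨false, a, by simpa [signedRoot] using ha⟩
  · obtain ⟨a, ha⟩ := hex (-α) (by rw [hL.neg_pow, h, neg_neg])
    exact ⟨true, a, by simp [signedRoot, ha]⟩

theorem signedRoot_pow_two_mul (hη : IsPrimitiveRoot η L) (b : Bool) (a : ZMod L) :
    signedRoot η b a ^ (2 * L) = 1 := by
  have : (η ^ a.val) ^ L = 1 := by rw [pow_right_comm, hη.pow_eq_one, one_pow]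
  have h2 : signedRoot η b a ^ 2 = (η ^ a.val) ^ 2 := by cases b <;> simp [signedRoot]
  rw [pow_mul, h2, ← pow_mul, mul_comm, pow_mul, this, one_pow]

theorem splits_X_pow_two_mul_sub_one (hη : IsPrimitiveRoot η L) (hL : Odd L) :
    (X ^ (2 * L) - 1 : K[X]).Splits := by
  have h1 : (X ^ L - 1 : K[X]).Splits := by simpa using X_pow_sub_one_splits hη
  -- For odd `L`, substituting `-X` turns `X ^ L - 1` into `-(X ^ L + 1)`.
  have h2 : (X ^ (2 * L) - 1 : K[X]) = (X ^ L - 1) * -((X ^ L - 1 : K[X]).comp (-X)) := by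
    simp [hL.neg_pow]
    ring
  rw [h2]
  exact h1.mul h1.comp_neg_X.neg

end SignedRoots

/-! ### Transfer of the classification to subsets of `ZMod L`. -/

section SignedClassification

variable {F K : Type*} [Field F] [Field K] [Algebra F K] {L : ℕ} {η : K}

theorem isIntegral_signedRoot [NeZero L] (hη : IsPrimitiveRoot η L) (b : Bool) (a : ZMod L) :
    IsIntegral F (signedRoot η b a) :=
  ⟨X ^ (2 * L) - 1, monic_X_pow_sub_one (mul_ne_zero two_ne_zero (NeZero.ne L)), by
    simp [signedRoot_pow_two_mul hη]⟩

theorem aeval_minpoly_signedRoot_eq_zero_iff [Fintype F] [NeZero L] (hη : IsPrimitiveRoot η L) (hL : Odd L)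
    (h2 : (2 : K) ≠ 0) {q : ℕ} (hq : Fintype.card F = q) (hq2 : Odd q) {b b' : Bool}
    {a a' : ZMod L} :
    aeval (signedRoot η b' a') (minpoly F (signedRoot η b a)) = 0 ↔
      b' = b ∧ a' ∈ cyclotomicCoset q L a := by
  rw [← isConjRoot_iff_aeval_eq_zero (isIntegral_signedRoot hη b a), isConjRoot_def,
    minpoly_eq_iff_exists_pow (isIntegral_signedRoot hη b a), hq]
  simp only [signedRoot_pow hη _ _ hq2]
  constructor
  · rintro ⟨i, hi⟩
    obtain ⟨h1, h2⟩ := signedRoot_injective hη hL h2 hi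
    exact ⟨h1, i, h2⟩
  · rintro ⟨rfl, i, rfl⟩
    exact ⟨i, rfl⟩

theorem minpoly_signedRoot_dvd (hη : IsPrimitiveRoot η L) (b : Bool) (a : ZMod L) :
    minpoly F (signedRoot η b a) ∣ X ^ (2 * L) - 1 :=
  minpoly.dvd F _ (by simp [signedRoot_pow_two_mul hη])

/-- Conjugation and inversion both keep the sign, so a partition of the exponents into orbits, taken
once per sign, describes all roots. This doubles `Fintype.card κ`. -/
theorem signed_classification [Fintype F] [NeZero L] (hη : IsPrimitiveRoot η L) (hL : Odd L) (h2 : (2 : K) ≠ 0)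
    {q : ℕ} (hq : Fintype.card F = q) (hq2 : Odd q) (hLF : (L : F) ≠ 0) (p n : ℕ) [CharP F p]
    (hp : p.Prime) {κ : Type*} [Fintype κ] (S : κ → Set (ZMod L)) (P : Bool × κ → F[X])
    (hmonic : ∀ i, (P i).Monic) (hdvd : ∀ i, P i ∣ X ^ (2 * L) - 1)
    (hroots : ∀ i b a, aeval (signedRoot η b a) (P i) = 0 ↔ b = i.1 ∧ a ∈ S i.2)
    (hdisj : ∀ i j a, a ∈ S i → a ∈ S j → i = j) (hcover : ∀ a, ∃ i, a ∈ S i)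
    (hneg : ∀ i, ∀ a ∈ S i, -a ∈ S i)
    (horb : ∀ i, ∀ a ∈ S i, ∀ a' ∈ S i,
      a' ∈ cyclotomicCoset q L a ∨ a' ∈ cyclotomicCoset q L (-a))
    (hne : ∀ i, (S i).Nonempty) :
    {C : Submodule F (Fin (2 * L * p ^ n) → F) | IsCyclicCode C ∧ IsLCD C}.ncard
        = 2 ^ (2 * Fintype.card κ) ∧
      ∀ C : Submodule F (Fin (2 * L * p ^ n) → F), (IsCyclicCode C ∧ IsLCD C) ↔
        ∃ E : Bool × κ → ℕ, (∀ i, E i = 0 ∨ E i = p ^ n) ∧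
          IsGeneratorPolynomial C (∏ i, P i ^ E i) := by
  have : Fact p.Prime := ⟨hp⟩
  have h2L : 2 * L ≠ 0 := mul_ne_zero two_ne_zero (NeZero.ne L)
  have hs : ((X ^ (2 * L) - 1 : F[X]).map (algebraMap F K)).Splits := by
    simpa using splits_X_pow_two_mul_sub_one hη hL
  have hex : ∀ i, ∀ α : K, aeval α (P i) = 0 → ∃ b, ∃ a : ZMod L, signedRoot η b a = α := by
    intro i α hα
    refine exists_signedRoot_eq hη hL ?_
    have := aeval_eq_zero_of_dvd_aeval_eq_zero (hdvd i) hα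
    simpa [sub_eq_zero] using this
  have hdisj' : ∀ i j, ∀ α : K, aeval α (P i) = 0 → aeval α (P j) = 0 → i = j := by
    intro i j α hi hj
    obtain ⟨b, a, rfl⟩ := hex i α hi
    rw [hroots] at hi hj
    exact Prod.ext (hi.1.symm.trans hj.1) (hdisj _ _ a hi.2 hj.2)
  have h2F : (2 : F) ≠ 0 := fun h => h2 (by
    simpa only [map_ofNat, map_zero] using congr_arg (algebraMap F K) h)
  have hmain := cyclic_lcd_classification (K := K) (P := P) (Q := p ^ n) h2L
    (pow_ne_zero n hp.ne_zero) (by rw [pow_mul, sub_pow_char_pow, one_pow]) hs hmonic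
    (prod_eq_X_pow_sub_one h2L (X_pow_sub_one_separable_iff.2 (by
        push_cast
        exact mul_ne_zero h2F hLF)) hs hmonic hdvd hdisj' (by
      intro α hα
      obtain ⟨b, a, rfl⟩ := exists_signedRoot_eq hη hL hα
      obtain ⟨j, hj⟩ := hcover a
      exact ⟨(b, j), (hroots _ _ _).2 ⟨rfl, hj⟩⟩))
    hdisj' (by
      intro i α hi
      obtain ⟨b, a, rfl⟩ := hex i α hi
      rw [signedRoot_inv hη]
      rw [hroots] at hi ⊢
      exact ⟨hi.1, hneg _ _ hi.2⟩) (by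
      intro i α β hα hβ
      obtain ⟨b, a, rfl⟩ := hex i α hα
      obtain ⟨b', a', rfl⟩ := hex i β hβ
      rw [signedRoot_inv hη]
      rw [hroots] at hα hβ
      obtain rfl : b' = b := hβ.1.trans hα.1.symm
      have hc : ∀ c : ZMod L, a' ∈ cyclotomicCoset q L c →
          minpoly F (signedRoot η b' a') = minpoly F (signedRoot η b' c) := by
        intro c hc
        rw [← isConjRoot_def, IsConjRoot.comm, isConjRoot_iff_aeval_eq_zero (isIntegral_signedRoot hη _ _),
          aeval_minpoly_signedRoot_eq_zero_iff hη hL h2 hq hq2]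
        exact ⟨rfl, hc⟩
      exact (horb _ a hα.2 a' hβ.2).imp (hc a) (hc (-a))) (by
      intro i
      obtain ⟨a, ha⟩ := hne i.2
      exact ⟨_, (hroots i i.1 a).2 ⟨rfl, ha⟩⟩)
  simpa using hmain

end SignedClassification

/-! ### The order of `q` modulo `ℓ ^ r`. -/

section Orders

variable {ℓ q : ℕ} [Fact ℓ.Prime]

theorem natCast_pow_eq_one_iff {N : ℕ} (hq : 1 < q) (j : ℕ) :
    (q : ZMod N) ^ j = 1 ↔ N ∣ q ^ j - 1 := by
  rw [← ZMod.natCast_eq_zero_iff, Nat.cast_sub (Nat.one_le_pow _ _ (by omega)), sub_eq_zero]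
  push_cast
  rfl

theorem orderOf_natCast_pos {N : ℕ} [NeZero N] (h : q.Coprime N) : 0 < orderOf (q : ZMod N) := by
  rw [← ZMod.coe_unitOfCoprime q h, orderOf_units]
  exact orderOf_pos _

theorem lam_pos (hqℓ : q.Coprime ℓ) (r : ℕ) : 0 < lam ℓ q r :=
  Nat.mul_pos (orderOf_natCast_pos hqℓ) (pow_pos (Fact.out : ℓ.Prime).pos _)

/-- Lifting the exponent, for `ℓ` odd: `q ^ (f * i) - 1` has `ℓ`-adic valuation `s + v(i)`, hence `ℓ
^ r` divides it iff `ℓ ^ (r - s)` divides `i`, with truncated subtraction. -/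
theorem orderOf_natCast_prime_pow (hℓ2 : ℓ ≠ 2) (hq : 1 < q) (hqℓ : q.Coprime ℓ) {r : ℕ}
    (hr : 1 ≤ r) : orderOf (q : ZMod (ℓ ^ r)) = lam ℓ q r := by
  have hℓ : ℓ.Prime := Fact.out
  have : NeZero (ℓ ^ r) := ⟨pow_ne_zero r hℓ.ne_zero⟩
  have hf : 0 < ordMod ℓ q := orderOf_natCast_pos hqℓ
  have hqf : 1 < q ^ ordMod ℓ q := Nat.one_lt_pow hf.ne' hq
  have key : ∀ j, j ≠ 0 → ((q : ZMod (ℓ ^ r)) ^ j = 1 ↔ lam ℓ q r ∣ j) := by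
    intro j hj
    rw [natCast_pow_eq_one_iff hq]
    have hiff : ∀ i, i ≠ 0 → (ℓ ^ r ∣ q ^ (ordMod ℓ q * i) - 1 ↔ ℓ ^ (r - sVal ℓ q) ∣ i) := by
      intro i hi
      have h1 := padicValNat.pow_sub_pow (p := ℓ) (x := q ^ ordMod ℓ q) (y := 1)
        (hℓ.odd_of_ne_two hℓ2) hqf
        ((natCast_pow_eq_one_iff hq _).1 (pow_orderOf_eq_one _))
        (fun h => hℓ.one_lt.ne' (Nat.dvd_one.1
          (((hqℓ.pow_left _).symm.gcd_eq_one) ▸ Nat.dvd_gcd dvd_rfl h))) hi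
      rw [one_pow, ← pow_mul] at h1
      have h0 : q ^ (ordMod ℓ q * i) - 1 ≠ 0 := by
        have : 1 < q ^ (ordMod ℓ q * i) := Nat.one_lt_pow (mul_ne_zero hf.ne' hi) hq
        omega
      rw [padicValNat_dvd_iff_le h0, padicValNat_dvd_iff_le hi, h1, sVal]
      omega
    constructor
    · intro h
      have hfj : ordMod ℓ q ∣ j := by
        rw [ordMod, orderOf_dvd_iff_pow_eq_one, natCast_pow_eq_one_iff hq]
        exact (dvd_pow_self ℓ (by omega)).trans h
      obtain ⟨i, rfl⟩ := hfj
      exact mul_dvd_mul_left _ ((hiff i (right_ne_zero_of_mul hj)).1 h)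
    · rintro ⟨i, rfl⟩
      rw [lam, mul_assoc] at hj ⊢
      exact (hiff _ (right_ne_zero_of_mul hj)).2 (dvd_mul_right _ _)
  apply Nat.dvd_antisymm
  · exact orderOf_dvd_of_pow_eq_one ((key _ (lam_pos hqℓ r).ne').2 dvd_rfl)
  · rw [← key _ (orderOf_natCast_pos (hqℓ.pow_right r)).ne']
    exact pow_orderOf_eq_one _

/-- Half the order of `q` gives `x ≠ 1` with `(x - 1) * (x + 1) = 0`. The odd prime `ℓ` cannot
divide both factors, so `ℓ ^ m` divides one of them, necessarily `x + 1`. -/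
theorem exists_natCast_pow_eq_neg_one (hℓ2 : ℓ ≠ 2) (hq : 1 < q) (hqℓ : q.Coprime ℓ) {m : ℕ}
    (hm : 1 ≤ m) (hf : Even (ordMod ℓ q)) : ∃ t, (q : ZMod (ℓ ^ m)) ^ t = -1 := by
  have hℓ : ℓ.Prime := Fact.out
  obtain ⟨h, hh⟩ : Even (lam ℓ q m) := hf.mul_right _
  have h0 := lam_pos hqℓ m
  have ho := orderOf_natCast_prime_pow hℓ2 hq hqℓ hm
  refine ⟨h, ?_⟩
  have h1 : (q : ZMod (ℓ ^ m)) ^ h ≠ 1 := fun h' => by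
    have := Nat.le_of_dvd (by omega) (orderOf_dvd_of_pow_eq_one h')
    omega
  have h2 : (q : ZMod (ℓ ^ m)) ^ (h + h) = 1 := by rw [← hh, ← ho, pow_orderOf_eq_one]
  have e1 : ((q : ZMod (ℓ ^ m)) ^ h = 1) ↔ ((ℓ ^ m : ℕ) : ℤ) ∣ (q : ℤ) ^ h - 1 := by
    rw [← ZMod.intCast_zmod_eq_zero_iff_dvd]
    push_cast
    rw [sub_eq_zero]
  have e2 : ((q : ZMod (ℓ ^ m)) ^ h = -1) ↔ ((ℓ ^ m : ℕ) : ℤ) ∣ (q : ℤ) ^ h + 1 := by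
    rw [← ZMod.intCast_zmod_eq_zero_iff_dvd]
    push_cast
    rw [add_eq_zero_iff_eq_neg]
  have e3 : ((ℓ ^ m : ℕ) : ℤ) ∣ ((q : ℤ) ^ h - 1) * ((q : ℤ) ^ h + 1) := by
    rw [← ZMod.intCast_zmod_eq_zero_iff_dvd]
    push_cast
    rw [pow_add] at h2
    linear_combination h2
  rw [Ne, e1] at h1
  rw [e2]
  have hp : Prime (ℓ : ℤ) := Nat.prime_iff_prime_int.1 hℓ
  by_cases hd : (ℓ : ℤ) ∣ (q : ℤ) ^ h - 1
  · refine absurd (IsCoprime.dvd_of_dvd_mul_right ?_ e3) h1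
    rw [Nat.cast_pow]
    refine IsCoprime.pow_left ((Prime.coprime_iff_not_dvd hp).2 fun hd' => ?_)
    have h3 : (ℓ : ℤ) ∣ 2 := by
      have h5 : (2 : ℤ) = ((q : ℤ) ^ h + 1) - ((q : ℤ) ^ h - 1) := by ring
      rw [h5]
      exact dvd_sub hd' hd
    have h4 : ℓ ∣ 2 := by exact_mod_cast h3
    exact hℓ2 ((Nat.prime_dvd_prime_iff_eq hℓ Nat.prime_two).1 h4)
  · refine IsCoprime.dvd_of_dvd_mul_left ?_ e3
    rw [Nat.cast_pow]
    exact IsCoprime.pow_left ((Prime.coprime_iff_not_dvd hp).2 hd)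

end Orders

/-! ### The representatives `ℓ ^ (m - r) * g ^ k` of the nonzero cosets. -/

section Representatives

theorem rep_eq {ℓ m : ℕ} {g : (ZMod (ℓ ^ m))ˣ} (r k : ℕ) : rep g r k =
    (ℓ : ZMod (ℓ ^ m)) ^ (m - r) * ((g ^ k : (ZMod (ℓ ^ m))ˣ) : ZMod (ℓ ^ m)) := by
  simp [rep]

variable {ℓ m q : ℕ} [Fact ℓ.Prime]

theorem prime_pow_mul_eq_iff {r : ℕ} (hr : r ≤ m) (x y : ZMod (ℓ ^ m)) :
    (ℓ : ZMod (ℓ ^ m)) ^ (m - r) * x = (ℓ : ZMod (ℓ ^ m)) ^ (m - r) * y ↔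
      ZMod.castHom (pow_dvd_pow ℓ hr) (ZMod (ℓ ^ r)) x =
        ZMod.castHom (pow_dvd_pow ℓ hr) (ZMod (ℓ ^ r)) y := by
  have hℓ : ℓ.Prime := Fact.out
  obtain ⟨a, rfl⟩ := ZMod.intCast_surjective x
  obtain ⟨b, rfl⟩ := ZMod.intCast_surjective y
  rw [map_intCast, map_intCast, ZMod.intCast_eq_intCast_iff_dvd_sub]
  have h : ((ℓ : ZMod (ℓ ^ m)) ^ (m - r) * a = (ℓ : ZMod (ℓ ^ m)) ^ (m - r) * b) ↔
      ((ℓ ^ m : ℕ) : ℤ) ∣ (ℓ : ℤ) ^ (m - r) * b - (ℓ : ℤ) ^ (m - r) * a := by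
    rw [← ZMod.intCast_eq_intCast_iff_dvd_sub]
    push_cast
    rfl
  rw [h, ← mul_sub]
  have hm : ((ℓ ^ m : ℕ) : ℤ) = (ℓ : ℤ) ^ (m - r) * ((ℓ ^ r : ℕ) : ℤ) := by
    push_cast
    rw [← pow_add, Nat.sub_add_cancel hr]
  rw [hm]
  exact mul_dvd_mul_iff_left (pow_ne_zero _ (by exact_mod_cast hℓ.ne_zero))

/-- The quotient of `(ℤ/ℓ^r)ˣ` by the powers of `q`. -/
def UnitQuotient (hqℓ : q.Coprime ℓ) (r : ℕ) : Type :=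
  (ZMod (ℓ ^ r))ˣ ⧸ Subgroup.zpowers (ZMod.unitOfCoprime q (hqℓ.pow_right r))

noncomputable instance (hqℓ : q.Coprime ℓ) (r : ℕ) : CommGroup (UnitQuotient hqℓ r) :=
  QuotientGroup.Quotient.commGroup _

instance (hqℓ : q.Coprime ℓ) (r : ℕ) : Finite (UnitQuotient hqℓ r) := by
  have : NeZero (ℓ ^ r) := ⟨pow_ne_zero r (Fact.out : ℓ.Prime).ne_zero⟩
  exact Quotient.finite _

/-- The class of a unit modulo `ℓ ^ m` in the quotient of `(ℤ/ℓ^r)ˣ` by the powers of `q`. -/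
noncomputable def unitClass (hqℓ : q.Coprime ℓ) {r : ℕ} (hr : r ≤ m) :
    (ZMod (ℓ ^ m))ˣ →* UnitQuotient hqℓ r :=
  MonoidHom.comp (QuotientGroup.mk' _ : (ZMod (ℓ ^ r))ˣ →* UnitQuotient hqℓ r)
    (ZMod.unitsMap (pow_dvd_pow ℓ hr))

theorem unitClass_surjective (hqℓ : q.Coprime ℓ) {r : ℕ} (hr : r ≤ m) :
    Function.Surjective (unitClass hqℓ hr) := by
  have : NeZero (ℓ ^ m) := ⟨pow_ne_zero m (Fact.out : ℓ.Prime).ne_zero⟩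
  exact (QuotientGroup.mk'_surjective _).comp (ZMod.unitsMap_surjective (pow_dvd_pow ℓ hr))

/-- Multiplication by `ℓ ^ (m - r)` sees its argument only modulo `ℓ ^ r`, so lying in one coset
means that the units differ by a power of `q` modulo `ℓ ^ r`. -/
theorem mem_cyclotomicCoset_iff_unitClass (hqℓ : q.Coprime ℓ) {r : ℕ} (hr : r ≤ m)
    (u v : (ZMod (ℓ ^ m))ˣ) :
    (ℓ : ZMod (ℓ ^ m)) ^ (m - r) * v ∈
        cyclotomicCoset q (ℓ ^ m) ((ℓ : ZMod (ℓ ^ m)) ^ (m - r) * u) ↔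
      unitClass hqℓ hr u = unitClass hqℓ hr v := by
  have : NeZero (ℓ ^ r) := ⟨pow_ne_zero r (Fact.out : ℓ.Prime).ne_zero⟩
  have h1 : unitClass hqℓ hr u = unitClass hqℓ hr v ↔
      (ZMod.unitsMap (pow_dvd_pow ℓ hr) u)⁻¹ * ZMod.unitsMap (pow_dvd_pow ℓ hr) v ∈
        Subgroup.zpowers (ZMod.unitOfCoprime q (hqℓ.pow_right r)) := QuotientGroup.eq
  rw [h1, ← mem_powers_iff_mem_zpowers, Submonoid.mem_powers_iff]
  change (∃ i, _) ↔ _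
  refine exists_congr fun i => ?_
  have hc : ∀ w : (ZMod (ℓ ^ m))ˣ, ((ZMod.unitsMap (pow_dvd_pow ℓ hr) w : (ZMod (ℓ ^ r))ˣ) :
      ZMod (ℓ ^ r)) = ZMod.castHom (pow_dvd_pow ℓ hr) (ZMod (ℓ ^ r)) w := fun _ => rfl
  rw [mul_assoc, prime_pow_mul_eq_iff hr, eq_inv_mul_iff_mul_eq, Units.ext_iff, Units.val_mul,
    hc, hc, Units.val_pow_eq_pow_val, ZMod.coe_unitOfCoprime, map_mul, map_pow, map_natCast,
    eq_comm]

/-- The quotient has order `φ(ℓ ^ r) / λ(r)` by Lagrange and inherits the generator `g` from the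
units modulo `ℓ ^ m`. -/
theorem orderOf_unitClass_generator (hℓ2 : ℓ ≠ 2) (hq : 1 < q) (hqℓ : q.Coprime ℓ) {r : ℕ}
    (hr1 : 1 ≤ r) (hr : r ≤ m) {g : (ZMod (ℓ ^ m))ˣ} (hg : ∀ x, x ∈ Subgroup.zpowers g) :
    orderOf (unitClass hqℓ hr g) = delta ℓ q r ∧
      ∀ x, x ∈ Subgroup.zpowers (unitClass hqℓ hr g) := by
  have : NeZero (ℓ ^ r) := ⟨pow_ne_zero r (Fact.out : ℓ.Prime).ne_zero⟩
  have hgen : ∀ x, x ∈ Subgroup.zpowers (unitClass hqℓ hr g) := by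
    intro x
    obtain ⟨u, rfl⟩ := unitClass_surjective hqℓ hr x
    obtain ⟨k, rfl⟩ := hg u
    exact Subgroup.mem_zpowers_iff.2 ⟨k, (map_zpow _ _ _).symm⟩
  refine ⟨?_, hgen⟩
  rw [orderOf_eq_card_of_forall_mem_zpowers hgen, delta, UnitQuotient]
  have h1 := Subgroup.card_eq_card_quotient_mul_card_subgroup
    (Subgroup.zpowers (ZMod.unitOfCoprime q (hqℓ.pow_right r)))
  rw [Nat.card_zpowers, ← orderOf_units, ZMod.coe_unitOfCoprime,
    orderOf_natCast_prime_pow hℓ2 hq hqℓ hr1, Nat.card_eq_fintype_card (α := (ZMod (ℓ ^ r))ˣ),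
    ZMod.card_units_eq_totient] at h1
  rw [h1, Nat.mul_div_cancel _ (lam_pos hqℓ r)]

variable {g : (ZMod (ℓ ^ m))ˣ}

theorem delta_pos (hℓ2 : ℓ ≠ 2) (hq : 1 < q) (hqℓ : q.Coprime ℓ) {r : ℕ}
    (hr1 : 1 ≤ r) (hr : r ≤ m) (hg : ∀ x, x ∈ Subgroup.zpowers g) : 0 < delta ℓ q r := by
  have : NeZero (ℓ ^ r) := ⟨pow_ne_zero r (Fact.out : ℓ.Prime).ne_zero⟩
  rw [← (orderOf_unitClass_generator hℓ2 hq hqℓ hr1 hr hg).1]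
  exact orderOf_pos (unitClass hqℓ hr g)

theorem rep_mem_cyclotomicCoset_rep_iff (hℓ2 : ℓ ≠ 2) (hq : 1 < q) (hqℓ : q.Coprime ℓ) {r : ℕ}
    (hr1 : 1 ≤ r) (hr : r ≤ m) (hg : ∀ x, x ∈ Subgroup.zpowers g) (k k' : ℕ) :
    rep g r k' ∈ cyclotomicCoset q (ℓ ^ m) (rep g r k) ↔ k ≡ k' [MOD delta ℓ q r] := by
  rw [rep_eq, rep_eq, mem_cyclotomicCoset_iff_unitClass hqℓ hr, map_pow, map_pow,
    pow_eq_pow_iff_modEq, (orderOf_unitClass_generator hℓ2 hq hqℓ hr1 hr hg).1]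

theorem prime_pow_mul_unit_injective {r r' : ℕ} (hr1 : 1 ≤ r) (hr : r ≤ m) (hr1' : 1 ≤ r')
    (hr' : r' ≤ m) (u v : (ZMod (ℓ ^ m))ˣ)
    (h : (ℓ : ZMod (ℓ ^ m)) ^ (m - r) * u = (ℓ : ZMod (ℓ ^ m)) ^ (m - r') * v) : r = r' := by
  have hℓ : ℓ.Prime := Fact.out
  have key : ∀ {r r' : ℕ}, 1 ≤ r → r ≤ m → r' ≤ m → ∀ u v : (ZMod (ℓ ^ m))ˣ,
      (ℓ : ZMod (ℓ ^ m)) ^ (m - r) * u = (ℓ : ZMod (ℓ ^ m)) ^ (m - r') * v → ¬ r < r' := by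
    intro r r' hr1 hr hr' u v h hlt
    have h0 : (ℓ : ZMod (ℓ ^ m)) ^ m = 0 := by
      have := ZMod.natCast_self (ℓ ^ m)
      push_cast at this
      exact this
    have h1 : (ℓ : ZMod (ℓ ^ m)) ^ (r + (m - r')) * v = 0 := by
      -- Multiplying by `ℓ ^ r` kills the left-hand side of `h`, but not the right-hand side when `r
      -- < r'`.
      rw [pow_add, mul_assoc, ← h, ← mul_assoc, ← pow_add, Nat.add_sub_cancel' hr, h0, zero_mul]
    rw [Units.mul_left_eq_zero] at h1
    have h2 : ℓ ^ m ∣ ℓ ^ (r + (m - r')) := by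
      rw [← ZMod.natCast_eq_zero_iff]
      push_cast
      exact h1
    have := (Nat.pow_dvd_pow_iff_le_right hℓ.one_lt).1 h2
    omega
  exact le_antisymm (not_lt.1 (key hr1' hr' hr v u h.symm)) (not_lt.1 (key hr1 hr hr' u v h))

theorem eq_of_mem_cyclotomicCoset_rep (hqℓ : q.Coprime ℓ) {r r' k k' : ℕ} (hr1 : 1 ≤ r)
    (hr : r ≤ m) (hr1' : 1 ≤ r') (hr' : r' ≤ m)
    (h : rep g r' k' ∈ cyclotomicCoset q (ℓ ^ m) (rep g r k)) : r = r' := by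
  obtain ⟨i, hi⟩ := h
  refine (prime_pow_mul_unit_injective hr1' hr' hr1 hr (g ^ k')
    (g ^ k * ZMod.unitOfCoprime q (hqℓ.pow_right m) ^ i) ?_).symm
  rw [← rep_eq, hi, rep_eq]
  simp [mul_assoc]

theorem rep_ne_zero {r : ℕ} (hr1 : 1 ≤ r) (hr : r ≤ m) (k : ℕ) : rep g r k ≠ 0 := by
  have hℓ : ℓ.Prime := Fact.out
  rw [rep_eq, Ne, Units.mul_left_eq_zero]
  intro h
  have h2 : ℓ ^ m ∣ ℓ ^ (m - r) := by
    rw [← ZMod.natCast_eq_zero_iff]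
    push_cast
    exact h
  have := (Nat.pow_dvd_pow_iff_le_right hℓ.one_lt).1 h2
  omega

theorem exists_rep_mem (hℓ2 : ℓ ≠ 2) (hq : 1 < q) (hqℓ : q.Coprime ℓ)
    (hg : ∀ x, x ∈ Subgroup.zpowers g) {a : ZMod (ℓ ^ m)} (ha : a ≠ 0) :
    ∃ r k, 1 ≤ r ∧ r ≤ m ∧ k < delta ℓ q r ∧ a ∈ cyclotomicCoset q (ℓ ^ m) (rep g r k) := by
  have hℓ : ℓ.Prime := Fact.out
  have : NeZero (ℓ ^ m) := ⟨pow_ne_zero m hℓ.ne_zero⟩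
  have hv : a.val ≠ 0 := by rwa [Ne, ZMod.val_eq_zero]
  obtain ⟨i, b, hb, hab⟩ := Nat.exists_eq_pow_mul_and_not_dvd hv ℓ hℓ.ne_one
  have hi : i < m := by
    by_contra hi
    have h1 : ℓ ^ m ∣ a.val := by
      rw [hab]
      exact (pow_dvd_pow ℓ (not_lt.1 hi)).mul_right b
    exact hv (Nat.eq_zero_of_dvd_of_lt h1 (ZMod.val_lt a))
  have hbc : b.Coprime (ℓ ^ m) := (((Nat.Prime.coprime_iff_not_dvd hℓ).2 hb).symm).pow_right m
  have hae : a = (ℓ : ZMod (ℓ ^ m)) ^ (m - (m - i)) * ZMod.unitOfCoprime b hbc := by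
    rw [ZMod.coe_unitOfCoprime, Nat.sub_sub_self hi.le]
    have := congr_arg (Nat.cast : ℕ → ZMod (ℓ ^ m)) hab
    simpa using this
  have hr1 : 1 ≤ m - i := by omega
  have hr : m - i ≤ m := by omega
  obtain ⟨ho, hgen⟩ := orderOf_unitClass_generator hℓ2 hq hqℓ hr1 hr hg
  have : NeZero (ℓ ^ (m - i)) := ⟨pow_ne_zero _ hℓ.ne_zero⟩
  obtain ⟨k, hk⟩ := mem_powers_iff_mem_zpowers.2 (hgen (unitClass hqℓ hr (ZMod.unitOfCoprime b hbc)))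
  have hδ := delta_pos hℓ2 hq hqℓ hr1 hr hg
  refine ⟨m - i, k % delta ℓ q (m - i), hr1, hr, Nat.mod_lt _ hδ, ?_⟩
  rw [hae, rep_eq, mem_cyclotomicCoset_iff_unitClass hqℓ hr, map_pow, ← ho, pow_mod_orderOf]
  exact hk

/-- The powers of `q` modulo `ℓ ^ r` form a group of odd order `λ(r)`, so they omit `-1`. Its class
therefore has order two in a cyclic group of order `δ(r)`, and must be the power `δ(r) / 2` of the
generator. -/
theorem neg_rep_mem (hℓ2 : ℓ ≠ 2) (hq : 1 < q) (hqℓ : q.Coprime ℓ)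
    (hg : ∀ x, x ∈ Subgroup.zpowers g) (hf : Odd (ordMod ℓ q)) {r : ℕ} (hr1 : 1 ≤ r)
    (hr : r ≤ m) :
    Even (delta ℓ q r) ∧
      ∀ k, -rep g r k ∈ cyclotomicCoset q (ℓ ^ m) (rep g r (k + delta ℓ q r / 2)) := by
  have hℓ : ℓ.Prime := Fact.out
  have : Fact (1 < ℓ ^ r) := ⟨Nat.one_lt_pow (by omega) hℓ.one_lt⟩
  have hodd : Odd ℓ := hℓ.odd_of_ne_two hℓ2
  have : NeZero (ℓ ^ r) := ⟨pow_ne_zero r hℓ.ne_zero⟩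
  obtain ⟨ho, hgen⟩ := orderOf_unitClass_generator hℓ2 hq hqℓ hr1 hr hg
  set γ := unitClass hqℓ hr g
  have hlam : Odd (lam ℓ q r) := hf.mul hodd.pow
  have hne : unitClass hqℓ hr (-1) ≠ 1 := by
    intro h
    have h1 : ZMod.unitsMap (pow_dvd_pow ℓ hr) (-1) ∈
        Subgroup.zpowers (ZMod.unitOfCoprime q (hqℓ.pow_right r)) :=
      (QuotientGroup.eq_one_iff _).1 h
    have h2 : ZMod.unitsMap (pow_dvd_pow ℓ hr) (-1) = -1 := by
      ext
      simp [ZMod.unitsMap_def]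
    rw [h2] at h1
    have h3 := orderOf_dvd_of_mem_zpowers h1
    rw [← orderOf_units, ← orderOf_units, ZMod.coe_unitOfCoprime, Units.val_neg, Units.val_one,
      orderOf_natCast_prime_pow hℓ2 hq hqℓ hr1, orderOf_neg_one, ZMod.ringChar_zmod_n,
      if_neg] at h3
    · exact (Nat.not_even_iff_odd.2 hlam) (even_iff_two_dvd.2 h3)
    · intro h4
      have := hodd.pow (n := r)
      rw [h4] at this
      exact absurd this (by decide)
  have hsq : unitClass hqℓ hr (-1) ^ 2 = 1 := by rw [← map_pow]; simp
  obtain ⟨j₀, hj₀⟩ := mem_powers_iff_mem_zpowers.2 (hgen (unitClass hqℓ hr (-1)))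
  have hδ := delta_pos hℓ2 hq hqℓ hr1 hr hg
  have hj : γ ^ (j₀ % delta ℓ q r) = unitClass hqℓ hr (-1) := by
    rw [← ho, pow_mod_orderOf]
    exact hj₀
  have hlt : j₀ % delta ℓ q r < delta ℓ q r := Nat.mod_lt _ hδ
  generalize j₀ % delta ℓ q r = j at hj hlt
  have hj0 : j ≠ 0 := by
    rintro rfl
    exact hne (by rw [← hj, pow_zero])
  have hd : delta ℓ q r ∣ j * 2 := by
    rw [← ho, orderOf_dvd_iff_pow_eq_one, pow_mul, hj, hsq]
  obtain ⟨c, hc⟩ := hd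
  -- From `j * 2 = δ(r) * c` with `0 < j < δ(r)`.
  have hc1 : c = 1 := by
    have h1 : c ≠ 0 := by rintro rfl; omega
    have h2 : c < 2 := by
      by_contra h
      have : delta ℓ q r * 2 ≤ delta ℓ q r * c := Nat.mul_le_mul_left _ (not_lt.1 h)
      omega
    omega
  rw [hc1, mul_one] at hc
  refine ⟨⟨j, by omega⟩, fun k => ?_⟩
  have hneg : -rep g r k = (ℓ : ZMod (ℓ ^ m)) ^ (m - r) *
      ((-1 * g ^ k : (ZMod (ℓ ^ m))ˣ) : ZMod (ℓ ^ m)) := by simp [rep]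
  rw [hneg, rep_eq, mem_cyclotomicCoset_iff_unitClass hqℓ hr, map_mul, map_pow, map_pow, ← hj,
    pow_add, mul_comm, show delta ℓ q r / 2 = j by omega]

end Representatives

/-! ### Counting the cosets. -/

section CosetCount

variable {ℓ m q : ℕ} [Fact ℓ.Prime] {g : (ZMod (ℓ ^ m))ˣ}

theorem rep_index_unique (hℓ2 : ℓ ≠ 2) (hq : 1 < q) (hqℓ : q.Coprime ℓ)
    (hg : ∀ x, x ∈ Subgroup.zpowers g) {r r' k k' : ℕ} (hr : r ∈ Finset.Icc 1 m)
    (hr' : r' ∈ Finset.Icc 1 m) (hk : k < delta ℓ q r) (hk' : k' < delta ℓ q r')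
    {a : ZMod (ℓ ^ m)} (ha : a ∈ cyclotomicCoset q (ℓ ^ m) (rep g r k))
    (ha' : a ∈ cyclotomicCoset q (ℓ ^ m) (rep g r' k')) : r = r' ∧ k = k' := by
  have : NeZero (ℓ ^ m) := ⟨pow_ne_zero m (Fact.out : ℓ.Prime).ne_zero⟩
  rw [Finset.mem_Icc] at hr hr'
  have h := mem_cyclotomicCoset_trans ha (mem_cyclotomicCoset_symm (hqℓ.pow_right m) ha')
  obtain rfl := eq_of_mem_cyclotomicCoset_rep hqℓ hr.1 hr.2 hr'.1 hr'.2 h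
  rw [rep_mem_cyclotomicCoset_rep_iff hℓ2 hq hqℓ hr.1 hr.2 hg] at h
  exact ⟨rfl, h.eq_of_lt_of_lt hk hk'⟩

theorem zero_notMem_cyclotomicCoset_rep (hqℓ : q.Coprime ℓ) {r k : ℕ}
    (hr : r ∈ Finset.Icc 1 m) : (0 : ZMod (ℓ ^ m)) ∉ cyclotomicCoset q (ℓ ^ m) (rep g r k) := by
  have : NeZero (ℓ ^ m) := ⟨pow_ne_zero m (Fact.out : ℓ.Prime).ne_zero⟩
  rw [Finset.mem_Icc] at hr
  intro h
  exact rep_ne_zero hr.1 hr.2 k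
    (mem_cyclotomicCoset_zero.1 (mem_cyclotomicCoset_symm (hqℓ.pow_right m) h))

theorem card_cosetEnumeration (hℓ2 : ℓ ≠ 2) (hq : 1 < q) (hqℓ : q.Coprime ℓ)
    (hg : ∀ x, x ∈ Subgroup.zpowers g) {e : ℕ} {ρ : Fin (e + 1) → ZMod (ℓ ^ m)}
    (hρ : IsCosetEnumeration q (ℓ ^ m) e ρ) : e = ∑ r ∈ Finset.Icc 1 m, delta ℓ q r := by
  have : NeZero (ℓ ^ m) := ⟨pow_ne_zero m (Fact.out : ℓ.Prime).ne_zero⟩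
  have hqL := hqℓ.pow_right m
  obtain ⟨-, hinj, hsurj⟩ := hρ
  -- A second irredundant list of all cosets; `none` is the zero coset and accounts for the `1` in
  -- `e + 1`.
  let R : Option (Σ r : Finset.Icc 1 m, Fin (delta ℓ q r)) → ZMod (ℓ ^ m) := fun o =>
    o.elim 0 fun x => rep g x.1 x.2
  have hR : Function.Injective fun o => cyclotomicCoset q (ℓ ^ m) (R o) := by
    intro o o' h
    have h' := (cyclotomicCoset_eq_iff hqL).1 h.symm
    rcases o with - | ⟨⟨r, hr⟩, k, hk⟩ <;> rcases o' with - | ⟨⟨r', hr'⟩, k', hk'⟩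
    · rfl
    · exact absurd h' (zero_notMem_cyclotomicCoset_rep hqℓ hr')
    · exact absurd ((cyclotomicCoset_eq_iff hqL).1 h) (zero_notMem_cyclotomicCoset_rep hqℓ hr)
    · obtain ⟨rfl, rfl⟩ := rep_index_unique hℓ2 hq hqℓ hg hr hr' hk hk'
        (mem_cyclotomicCoset_self _) h'
      rfl
  have hrange : Set.range (fun i => cyclotomicCoset q (ℓ ^ m) (ρ i)) =
      Set.range fun o => cyclotomicCoset q (ℓ ^ m) (R o) := by
    apply Set.Subset.antisymm
    · rintro _ ⟨i, rfl⟩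
      rcases eq_or_ne (ρ i) 0 with h | h
      · exact ⟨none, by simp [R, h]⟩
      · obtain ⟨r, k, hr1, hr, hk, hmem⟩ := exists_rep_mem hℓ2 hq hqℓ hg h
        exact ⟨some ⟨⟨r, Finset.mem_Icc.2 ⟨hr1, hr⟩⟩, ⟨k, hk⟩⟩,
          (cyclotomicCoset_eq_iff hqL).2 hmem⟩
    · rintro _ ⟨o, rfl⟩
      exact hsurj (R o)
  have h1 := Nat.card_range_of_injective hinj
  rw [hrange, Nat.card_range_of_injective hR, Nat.card_eq_fintype_card,
    Nat.card_eq_fintype_card, Fintype.card_option, Fintype.card_sigma, Fintype.card_fin] at h1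
  simp only [Fintype.card_fin] at h1
  rw [Finset.sum_coe_sort (Finset.Icc 1 m) (fun r => delta ℓ q r)] at h1
  omega

theorem mem_cyclotomicCoset_neg_rep_iff (hℓ2 : ℓ ≠ 2) (hq : 1 < q) (hqℓ : q.Coprime ℓ)
    (hg : ∀ x, x ∈ Subgroup.zpowers g) (hf : Odd (ordMod ℓ q)) {r k : ℕ}
    (hr : r ∈ Finset.Icc 1 m) {a : ZMod (ℓ ^ m)} :
    a ∈ cyclotomicCoset q (ℓ ^ m) (-rep g r k) ↔
      a ∈ cyclotomicCoset q (ℓ ^ m) (rep g r (k + delta ℓ q r / 2)) := by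
  have : NeZero (ℓ ^ m) := ⟨pow_ne_zero m (Fact.out : ℓ.Prime).ne_zero⟩
  rw [Finset.mem_Icc] at hr
  rw [(cyclotomicCoset_eq_iff (hqℓ.pow_right m)).2 ((neg_rep_mem hℓ2 hq hqℓ hg hf hr.1 hr.2).2 k)]

end CosetCount

/-! ### The two parities of `f`. -/

section MainCases

variable {F K : Type*} [Field F] [Field K] [Algebra F K] {ℓ m q : ℕ} {η : K}

theorem hat_minPow {L : ℕ} (a : ZMod L) :
    hat (minPow F η a) = minpoly F (signedRoot η false a) :=
  hat_minpoly _

theorem hat_minPow_comp_neg_X {L : ℕ} [NeZero L] (hη : IsPrimitiveRoot η L) (a : ZMod L) :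
    hat ((minPow F η a).comp (-X)) = minpoly F (signedRoot η true a) :=
  hat_minpoly_comp_neg_X (isIntegral_signedRoot hη false a)

theorem evenGenerator_eq_prod {L e : ℕ} [NeZero L] (hη : IsPrimitiveRoot η L) (ρ : Fin (e + 1) → ZMod L)
    (E : Bool × Fin (e + 1) → ℕ) :
    evenGenerator F η ρ (fun i => E (false, i)) (fun i => E (true, i)) =
      ∏ i, minpoly F (signedRoot η i.1 (ρ i.2)) ^ E i := by
  rw [Fintype.prod_prod_type_right, evenGenerator]
  refine Finset.prod_congr rfl fun i _ => ?_
  rw [Fintype.prod_bool, hat_minPow, hat_minPow_comp_neg_X hη, mul_comm]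

/-- The exponents of the generator polynomial as one family, the sign being the first index. -/
def oddExponent (δ : ℕ → ℕ) (m a b : ℕ) (ε σ : ℕ → ℕ → ℕ) :
    Bool × Option (Σ r : Finset.Icc 1 m, Fin (δ r / 2)) → ℕ
  | (false, none) => a
  | (true, none) => b
  | (false, some x) => ε x.1 x.2
  | (true, some x) => σ x.1 x.2

theorem exists_eq_oddExponent (δ : ℕ → ℕ) (m : ℕ)
    (E : Bool × Option (Σ r : Finset.Icc 1 m, Fin (δ r / 2)) → ℕ) :
    ∃ a b ε σ, E = oddExponent δ m a b ε σ := by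
  classical
  -- Exponents outside the index range never enter the product; they are set to `0`.
  refine ⟨E (false, none), E (true, none),
    fun r k => if h : r ∈ Finset.Icc 1 m ∧ k < δ r / 2 then
      E (false, some ⟨⟨r, h.1⟩, ⟨k, h.2⟩⟩) else 0,
    fun r k => if h : r ∈ Finset.Icc 1 m ∧ k < δ r / 2 then
      E (true, some ⟨⟨r, h.1⟩, ⟨k, h.2⟩⟩) else 0, ?_⟩
  funext ⟨s, o⟩
  rcases o with - | ⟨⟨r, hr⟩, k, hk⟩
  · cases s <;> rfl
  · have hk' : k < δ r / 2 := hk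
    cases s <;> simp only [oddExponent] <;> rw [dif_pos (And.intro hr hk')]

theorem forall_oddExponent_iff {δ : ℕ → ℕ} {m a b : ℕ} {ε σ : ℕ → ℕ → ℕ} {p : ℕ → Prop} :
    (∀ i, p (oddExponent δ m a b ε σ i)) ↔ p a ∧ p b ∧
      ∀ r ∈ Finset.Icc 1 m, ∀ k ∈ Finset.range (δ r / 2), p (ε r k) ∧ p (σ r k) := by
  constructor
  · intro h
    refine ⟨h (false, none), h (true, none), fun r hr k hk => ?_⟩
    rw [Finset.mem_range] at hk
    exact ⟨h (false, some ⟨⟨r, hr⟩, ⟨k, hk⟩⟩), h (true, some ⟨⟨r, hr⟩, ⟨k, hk⟩⟩)⟩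
  · rintro ⟨ha, hb, h⟩ ⟨s, o⟩
    rcases o with - | ⟨⟨r, hr⟩, k, hk⟩ <;> cases s
    · exact ha
    · exact hb
    · exact (h r hr k (Finset.mem_range.2 hk)).1
    · exact (h r hr k (Finset.mem_range.2 hk)).2

/-- The polynomials whose roots are the orbits under conjugation and inversion when `-1` is not
a power of `q`. -/
noncomputable def oddFactor (F : Type*) {K : Type*} [Field F] [Field K] [Algebra F K]
    (δ : ℕ → ℕ) (η : K) (g : (ZMod (ℓ ^ m))ˣ) :
    Bool × Option (Σ r : Finset.Icc 1 m, Fin (δ r / 2)) → F[X]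
  | (s, none) => minpoly F (signedRoot η s (0 : ZMod (ℓ ^ m)))
  | (s, some x) => minpoly F (signedRoot η s (rep g x.1 x.2)) *
      minpoly F (signedRoot η s (-rep g x.1 x.2))

theorem minpoly_signedRoot_zero (s : Bool) (L : ℕ) :
    minpoly F (signedRoot η s (0 : ZMod L)) = bif s then X + 1 else X - 1 := by
  cases s
  · simp [signedRoot]
  · simpa [signedRoot] using minpoly.eq_X_sub_C K (-1 : F)

theorem oddGenerator_eq_prod [NeZero (ℓ ^ m)] (hη : IsPrimitiveRoot η (ℓ ^ m)) (g : (ZMod (ℓ ^ m))ˣ) (a b : ℕ)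
    (ε σ : ℕ → ℕ → ℕ) :
    oddGenerator F q η g a b ε σ =
      ∏ i, oddFactor F (delta ℓ q) η g i ^ oddExponent (delta ℓ q) m a b ε σ i := by
  rw [Fintype.prod_prod_type, Fintype.prod_bool, Fintype.prod_option, Fintype.prod_option,
    Fintype.prod_sigma, Fintype.prod_sigma]
  have h1 : ∀ r : Finset.Icc 1 m, ∀ k : Fin (delta ℓ q r / 2),
      oddFactor F (delta ℓ q) η g (false, some ⟨r, k⟩) ^
          oddExponent (delta ℓ q) m a b ε σ (false, some ⟨r, k⟩) =
        minPow F η (rep g r k) ^ ε r k * minPow F η (-rep g r k) ^ ε r k := fun r k =>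
    mul_pow _ _ _
  have h2 : ∀ r : Finset.Icc 1 m, ∀ k : Fin (delta ℓ q r / 2),
      oddFactor F (delta ℓ q) η g (true, some ⟨r, k⟩) ^
          oddExponent (delta ℓ q) m a b ε σ (true, some ⟨r, k⟩) =
        hat ((minPow F η (rep g r k)).comp (-X)) ^ σ r k *
          hat ((minPow F η (-rep g r k)).comp (-X)) ^ σ r k := fun r k => by
    rw [hat_minPow_comp_neg_X hη, hat_minPow_comp_neg_X hη]
    exact mul_pow _ _ _
  simp only [h1, h2]
  have h3 : ∀ s, oddFactor F (delta ℓ q) η g (s, none) = bif s then X + 1 else X - 1 :=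
    fun s => minpoly_signedRoot_zero s _
  rw [h3, h3, oddGenerator]
  have h4 : ∀ (T : ℕ → ℕ → F[X]),
      ∏ r : Finset.Icc 1 m, ∏ k : Fin (delta ℓ q r / 2), T r k =
        ∏ r ∈ Finset.Icc 1 m, ∏ k ∈ Finset.range (delta ℓ q r / 2), T r k := by
    intro T
    rw [← Finset.prod_coe_sort (Finset.Icc 1 m)]
    exact Finset.prod_congr rfl fun r _ => Fin.prod_univ_eq_prod_range (T r) _
  rw [h4 fun r k => minPow F η (rep g r k) ^ ε r k * minPow F η (-rep g r k) ^ ε r k,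
    h4 fun r k => hat ((minPow F η (rep g r k)).comp (-X)) ^ σ r k *
          hat ((minPow F η (-rep g r k)).comp (-X)) ^ σ r k]
  have h5 : ∀ A B C D : F[X], (B * C) * (A * D) = A * B * (D * C) := fun A B C D => by ring
  simp only [cond_true, cond_false]
  rw [oddExponent, oddExponent, h5, ← Finset.prod_mul_distrib]
  congr 1
  refine Finset.prod_congr rfl fun r _ => ?_
  rw [← Finset.prod_mul_distrib]
  exact Finset.prod_congr rfl fun k _ => by ring

variable [Fintype F] [Fact ℓ.Prime] {p n e : ℕ} [CharP F p] {g : (ZMod (ℓ ^ m))ˣ}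

theorem lcd_classification_of_even (hp : p.Prime) (hℓ2 : ℓ ≠ 2) (h2 : (2 : K) ≠ 0)
    (hq : Fintype.card F = q) (hq1 : 1 < q) (hq2 : Odd q) (hqℓ : q.Coprime ℓ)
    (hℓF : ((ℓ ^ m : ℕ) : F) ≠ 0) (hm : 1 ≤ m) (hη : IsPrimitiveRoot η (ℓ ^ m))
    {ρ : Fin (e + 1) → ZMod (ℓ ^ m)} (hρ : IsCosetEnumeration q (ℓ ^ m) e ρ)
    (hf : Even (ordMod ℓ q)) :
    {C : Submodule F (Fin (2 * ℓ ^ m * p ^ n) → F) | IsCyclicCode C ∧ IsLCD C}.ncard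
        = 2 ^ (2 * (e + 1)) ∧
    ∀ C : Submodule F (Fin (2 * ℓ ^ m * p ^ n) → F), (IsCyclicCode C ∧ IsLCD C) ↔
      ∃ ε ε' : Fin (e + 1) → ℕ,
        (∀ i, (ε i = 0 ∨ ε i = p ^ n) ∧ (ε' i = 0 ∨ ε' i = p ^ n)) ∧
        IsGeneratorPolynomial C (evenGenerator F η ρ ε ε') := by
  have hℓ : ℓ.Prime := Fact.out
  have : NeZero (ℓ ^ m) := ⟨pow_ne_zero m hℓ.ne_zero⟩
  have hL : Odd (ℓ ^ m) := (hℓ.odd_of_ne_two hℓ2).pow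
  have hqL := hqℓ.pow_right m
  obtain ⟨-, hinj, hsurj⟩ := hρ
  obtain ⟨t, ht⟩ := exists_natCast_pow_eq_neg_one hℓ2 hq1 hqℓ hm hf
  have hmain := signed_classification hη hL h2 hq hq2 hℓF p n hp
    (fun i => cyclotomicCoset q (ℓ ^ m) (ρ i))
    (fun i => minpoly F (signedRoot η i.1 (ρ i.2)))
    (fun i => minpoly.monic (isIntegral_signedRoot hη _ _))
    (fun i => minpoly_signedRoot_dvd hη _ _)
    (fun i b a => aeval_minpoly_signedRoot_eq_zero_iff hη hL h2 hq hq2)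
    (fun i j a hi hj => hinj (((cyclotomicCoset_eq_iff hqL).2 hi).trans
      ((cyclotomicCoset_eq_iff hqL).2 hj).symm))
    (fun a => (hsurj a).imp fun i hi => (cyclotomicCoset_eq_iff hqL).1 hi)
    -- Since `-1 = q ^ t`, each coset is already closed under negation.
    (fun i a ha => mem_cyclotomicCoset_trans ha ⟨t, by rw [ht, mul_neg_one]⟩)
    (fun i a ha a' ha' => Or.inl
      (mem_cyclotomicCoset_trans (mem_cyclotomicCoset_symm hqL ha) ha'))
    (fun i => ⟨_, mem_cyclotomicCoset_self _⟩)
  rw [Fintype.card_fin] at hmain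
  refine ⟨hmain.1, fun C => (hmain.2 C).trans ?_⟩
  constructor
  · rintro ⟨E, hE, hC⟩
    refine ⟨fun i => E (false, i), fun i => E (true, i), fun i => ⟨hE _, hE _⟩, ?_⟩
    rwa [evenGenerator_eq_prod hη]
  · rintro ⟨ε, ε', hE, hC⟩
    refine ⟨fun i => bif i.1 then ε' i.2 else ε i.2, ?_, ?_⟩
    · rintro ⟨b, i⟩
      cases b
      · exact (hE i).1
      · exact (hE i).2
    · rwa [← evenGenerator_eq_prod hη ρ fun i => bif i.1 then ε' i.2 else ε i.2]

theorem lcd_classification_of_odd (hp : p.Prime) (hℓ2 : ℓ ≠ 2) (h2 : (2 : K) ≠ 0)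
    (hq : Fintype.card F = q) (hq1 : 1 < q) (hq2 : Odd q) (hqℓ : q.Coprime ℓ)
    (hℓF : ((ℓ ^ m : ℕ) : F) ≠ 0) (hη : IsPrimitiveRoot η (ℓ ^ m))
    (hg : ∀ x, x ∈ Subgroup.zpowers g) (hf : Odd (ordMod ℓ q)) :
    {C : Submodule F (Fin (2 * ℓ ^ m * p ^ n) → F) | IsCyclicCode C ∧ IsLCD C}.ncard
        = 2 ^ (∑ r ∈ Finset.Icc 1 m, delta ℓ q r + 2) ∧
    ∀ C : Submodule F (Fin (2 * ℓ ^ m * p ^ n) → F), (IsCyclicCode C ∧ IsLCD C) ↔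
      ∃ (a b : ℕ) (ε σ : ℕ → ℕ → ℕ),
        (a = 0 ∨ a = p ^ n) ∧ (b = 0 ∨ b = p ^ n) ∧
        (∀ r ∈ Finset.Icc 1 m, ∀ k ∈ Finset.range (delta ℓ q r / 2),
          (ε r k = 0 ∨ ε r k = p ^ n) ∧ (σ r k = 0 ∨ σ r k = p ^ n)) ∧
        IsGeneratorPolynomial C (oddGenerator F q η g a b ε σ) := by
  have hℓ : ℓ.Prime := Fact.out
  have : NeZero (ℓ ^ m) := ⟨pow_ne_zero m hℓ.ne_zero⟩
  have hL : Odd (ℓ ^ m) := (hℓ.odd_of_ne_two hℓ2).pow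
  have hqL := hqℓ.pow_right m
  have heven : ∀ r ∈ Finset.Icc 1 m, delta ℓ q r = 2 * (delta ℓ q r / 2) := fun r hr => by
    rw [Finset.mem_Icc] at hr
    obtain ⟨c, hc⟩ := (neg_rep_mem hℓ2 hq1 hqℓ hg hf hr.1 hr.2).1
    omega
  -- Negation shifts `k` by `δ(r) / 2`, so each pair of opposite cosets has exactly one index `k`
  -- below `δ(r) / 2`.
  let S : Option (Σ r : Finset.Icc 1 m, Fin (delta ℓ q r / 2)) → Set (ZMod (ℓ ^ m)) := fun o =>
    o.elim {0} fun x => cyclotomicCoset q (ℓ ^ m) (rep g x.1 x.2) ∪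
      cyclotomicCoset q (ℓ ^ m) (-rep g x.1 x.2)
  have hS : ∀ x a, a ∈ S (some x) ↔ ∃ k, (k = (x.2 : ℕ) ∨ k = x.2 + delta ℓ q x.1 / 2) ∧
      a ∈ cyclotomicCoset q (ℓ ^ m) (rep g x.1 k) := by
    intro x a
    change _ ∨ _ ↔ _
    rw [mem_cyclotomicCoset_neg_rep_iff hℓ2 hq1 hqℓ hg hf x.1.2]
    constructor
    · rintro (h | h)
      · exact ⟨_, Or.inl rfl, h⟩
      · exact ⟨_, Or.inr rfl, h⟩
    · rintro ⟨k, rfl | rfl, h⟩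
      · exact Or.inl h
      · exact Or.inr h
  have hS0 : ∀ x, (0 : ZMod (ℓ ^ m)) ∉ S (some x) := fun x h => by
    obtain ⟨k, -, hk⟩ := (hS x 0).1 h
    exact zero_notMem_cyclotomicCoset_rep hqℓ x.1.2 hk
  have hroot := fun (b b' : Bool) (a a' : ZMod (ℓ ^ m)) =>
    aeval_minpoly_signedRoot_eq_zero_iff (F := F) hη hL h2 hq hq2 (b := b) (b' := b') (a := a)
      (a' := a')
  have hmain := signed_classification hη hL h2 hq hq2 hℓF p n hp S
    (oddFactor F (delta ℓ q) η g)
    (by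
      rintro ⟨s, - | x⟩
      · exact minpoly.monic (isIntegral_signedRoot hη _ _)
      · exact (minpoly.monic (isIntegral_signedRoot hη _ _)).mul
          (minpoly.monic (isIntegral_signedRoot hη _ _)))
    (by
      rintro ⟨s, - | x⟩
      · exact minpoly_signedRoot_dvd hη _ _
      -- The two irreducible factors differ because `k` and `k + δ(r) / 2` index distinct cosets.
      · refine IsCoprime.mul_dvd ?_ (minpoly_signedRoot_dvd hη _ _)
          (minpoly_signedRoot_dvd hη _ _)
        rw [(minpoly.irreducible (isIntegral_signedRoot hη s _)).coprime_iff_not_dvd]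
        intro h
        have h1 := aeval_eq_zero_of_dvd_aeval_eq_zero h (minpoly.aeval F _)
        rw [hroot, mem_cyclotomicCoset_neg_rep_iff hℓ2 hq1 hqℓ hg hf x.1.2] at h1
        have h3 := heven _ x.1.2
        have h4 := x.2.2
        have h5 := (rep_index_unique hℓ2 hq1 hqℓ hg x.1.2 x.1.2 (by omega) (by omega)
          (mem_cyclotomicCoset_self _) h1.2).2
        omega)
    (by
      rintro ⟨s, - | x⟩ b a
      · refine (hroot _ _ _ _).trans ?_
        rw [mem_cyclotomicCoset_zero]
        rfl
      · rw [oddFactor, map_mul, mul_eq_zero, hroot, hroot, ← and_or_left]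
        rfl)
    (by
      rintro (- | x) (- | y) a ha hb
      · rfl
      · obtain rfl : a = 0 := ha
        exact absurd hb (hS0 y)
      · obtain rfl : a = 0 := hb
        exact absurd ha (hS0 x)
      · obtain ⟨k, hk, hka⟩ := (hS x a).1 ha
        obtain ⟨k', hk', hka'⟩ := (hS y a).1 hb
        obtain ⟨⟨r, hr⟩, i, hi⟩ := x
        obtain ⟨⟨r', hr'⟩, j, hj⟩ := y
        have hi' : i < delta ℓ q r / 2 := hi
        have hj' : j < delta ℓ q r' / 2 := hj
        change k = i ∨ k = i + delta ℓ q r / 2 at hk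
        change k' = j ∨ k' = j + delta ℓ q r' / 2 at hk'
        have h3 := heven r hr
        have h4 := heven r' hr'
        obtain ⟨rfl, rfl⟩ := rep_index_unique hℓ2 hq1 hqℓ hg hr hr' (by omega) (by omega)
          hka hka'
        obtain rfl : i = j := by omega
        rfl)
    (by
      intro a
      rcases eq_or_ne a 0 with rfl | ha
      · exact ⟨none, rfl⟩
      · obtain ⟨r, k, hr1, hr, hk, hmem⟩ := exists_rep_mem hℓ2 hq1 hqℓ hg ha
        have hr' : r ∈ Finset.Icc 1 m := Finset.mem_Icc.2 ⟨hr1, hr⟩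
        have h3 := heven r hr'
        by_cases hk' : k < delta ℓ q r / 2
        · exact ⟨some ⟨⟨r, hr'⟩, ⟨k, hk'⟩⟩, (hS _ _).2 ⟨k, Or.inl rfl, hmem⟩⟩
        · have hlt : k - delta ℓ q r / 2 < delta ℓ q r / 2 := by omega
          refine ⟨some ⟨⟨r, hr'⟩, ⟨k - delta ℓ q r / 2, hlt⟩⟩,
            (hS _ _).2 ⟨k, Or.inr ?_, hmem⟩⟩
          exact (Nat.sub_add_cancel (not_lt.1 hk')).symm)
    (by
      rintro (- | x) a ha
      · obtain rfl : a = 0 := ha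
        exact neg_zero
      · rcases ha with h | h
        · exact Or.inr (neg_mem_cyclotomicCoset_neg h)
        · refine Or.inl ?_
          have := neg_mem_cyclotomicCoset_neg h
          rwa [neg_neg] at this)
    (by
      rintro (- | x) a ha a' ha'
      · obtain rfl : a = 0 := ha
        obtain rfl : a' = 0 := ha'
        exact Or.inl (mem_cyclotomicCoset_self _)
      · have key : ∀ b : ZMod (ℓ ^ m), a ∈ cyclotomicCoset q (ℓ ^ m) b →
            a' ∈ cyclotomicCoset q (ℓ ^ m) b → a' ∈ cyclotomicCoset q (ℓ ^ m) a := fun b h h' =>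
          mem_cyclotomicCoset_trans (mem_cyclotomicCoset_symm hqL h) h'
        rcases ha with h | h <;> rcases ha' with h' | h'
        · exact Or.inl (key _ h h')
        · exact Or.inr (mem_cyclotomicCoset_trans
            (mem_cyclotomicCoset_symm hqL (neg_mem_cyclotomicCoset_neg h)) h')
        · refine Or.inr (mem_cyclotomicCoset_trans
            (mem_cyclotomicCoset_symm hqL (neg_mem_cyclotomicCoset_neg h)) ?_)
          rwa [neg_neg]
        · exact Or.inl (key _ h h'))
    (by
      rintro (- | x)
      · exact ⟨0, rfl⟩
      · exact ⟨_, Or.inl (mem_cyclotomicCoset_self _)⟩)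
  constructor
  -- The exponent is `2 * (1 + ∑ δ(r) / 2)`, and evenness of each `δ(r)` makes the halving exact.
  · rw [hmain.1, Fintype.card_option, Fintype.card_sigma]
    simp only [Fintype.card_fin]
    rw [Finset.sum_coe_sort (Finset.Icc 1 m) (fun r => delta ℓ q r / 2), mul_add,
      Finset.mul_sum, ← Finset.sum_congr rfl heven]
  · intro C
    rw [hmain.2 C]
    constructor
    · rintro ⟨E, hE, hC⟩
      obtain ⟨a, b, ε, σ, rfl⟩ := exists_eq_oddExponent (delta ℓ q) m E
      obtain ⟨ha, hb, h⟩ := (forall_oddExponent_iff (p := fun x => x = 0 ∨ x = p ^ n)).1 hE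
      exact ⟨a, b, ε, σ, ha, hb, h, by rwa [oddGenerator_eq_prod hη]⟩
    · rintro ⟨a, b, ε, σ, ha, hb, h, hC⟩
      exact ⟨oddExponent (delta ℓ q) m a b ε σ,
        (forall_oddExponent_iff (p := fun x => x = 0 ∨ x = p ^ n)).2 ⟨ha, hb, h⟩,
        by rwa [← oddGenerator_eq_prod hη]⟩

end MainCases
end RepeatedRootCode

theorem mainTheorem5 {F K : Type*} [Field F] [Fintype F] [Field K] [Algebra F K]
    (p ℓ m n q e : ℕ) (hp : p.Prime) (hp2 : p ≠ 2) [CharP F p] (hq : Fintype.card F = q)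
    (hℓ : ℓ.Prime) (hℓ2 : ℓ ≠ 2) (hℓp : ℓ ≠ p) (hm : 1 ≤ m)
    (g : (ZMod (ℓ ^ m))ˣ) (hg : ∀ x : (ZMod (ℓ ^ m))ˣ, x ∈ Subgroup.zpowers g)
    (η : K) (hη : IsPrimitiveRoot η (ℓ ^ m))
    (ρ : Fin (e + 1) → ZMod (ℓ ^ m)) (hρ : IsCosetEnumeration q (ℓ ^ m) e ρ) :
    e = ∑ r ∈ Finset.Icc 1 m, delta ℓ q r ∧
    (Odd (ordMod ℓ q) →
      {C : Submodule F (Fin (2 * ℓ ^ m * p ^ n) → F) | IsCyclicCode C ∧ IsLCD C}.ncard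
          = 2 ^ (e + 2) ∧
      ∀ C : Submodule F (Fin (2 * ℓ ^ m * p ^ n) → F),
        (IsCyclicCode C ∧ IsLCD C) ↔
          ∃ (a b : ℕ) (ε σ : ℕ → ℕ → ℕ),
            (a = 0 ∨ a = p ^ n) ∧ (b = 0 ∨ b = p ^ n) ∧
            (∀ r ∈ Finset.Icc 1 m, ∀ k ∈ Finset.range (delta ℓ q r / 2),
              (ε r k = 0 ∨ ε r k = p ^ n) ∧ (σ r k = 0 ∨ σ r k = p ^ n)) ∧
            IsGeneratorPolynomial C (oddGenerator F q η g a b ε σ)) ∧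
    (Even (ordMod ℓ q) →
      {C : Submodule F (Fin (2 * ℓ ^ m * p ^ n) → F) | IsCyclicCode C ∧ IsLCD C}.ncard
          = 2 ^ (2 * (e + 1)) ∧
      ∀ C : Submodule F (Fin (2 * ℓ ^ m * p ^ n) → F),
        (IsCyclicCode C ∧ IsLCD C) ↔
          ∃ ε ε' : Fin (e + 1) → ℕ,
            (∀ i, (ε i = 0 ∨ ε i = p ^ n) ∧ (ε' i = 0 ∨ ε' i = p ^ n)) ∧
            IsGeneratorPolynomial C (evenGenerator F η ρ ε ε')) := by
  have : Fact ℓ.Prime := ⟨hℓ⟩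
  have hq1 : 1 < q := hq ▸ Fintype.one_lt_card
  obtain ⟨k, -, hk⟩ := FiniteField.card F p
  rw [hq] at hk
  have hq2 : Odd q := hk ▸ (hp.odd_of_ne_two hp2).pow
  have hqℓ : q.Coprime ℓ := hk ▸ ((Nat.coprime_primes hp hℓ).2 hℓp.symm).pow_left _
  have h2F : (2 : F) ≠ 0 := fun h => by
    have h' : ((2 : ℕ) : F) = 0 := by exact_mod_cast h
    rw [CharP.cast_eq_zero_iff F p] at h'
    exact hp2 ((Nat.prime_dvd_prime_iff_eq hp Nat.prime_two).1 h')
  have h2 : (2 : K) ≠ 0 := by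
    simpa only [map_ofNat] using (map_ne_zero (algebraMap F K)).2 h2F
  have hℓF : ((ℓ ^ m : ℕ) : F) ≠ 0 := by
    rw [Ne, CharP.cast_eq_zero_iff F p]
    exact fun h => hℓp ((Nat.prime_dvd_prime_iff_eq hp hℓ).1 (hp.dvd_of_dvd_pow h)).symm
  have he := card_cosetEnumeration hℓ2 hq1 hqℓ hg hρ
  refine ⟨he, fun hf => ?_, fun hf => ?_⟩
  · have h := lcd_classification_of_odd (n := n) hp hℓ2 h2 hq hq1 hq2 hqℓ hℓF hη hg hf
    rwa [← he] at h
  · exact lcd_classification_of_even hp hℓ2 h2 hq hq1 hq2 hqℓ hℓF hm hη hρ hf
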